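/- Conventions. A quantum algorithm is a family $\{A_\lambda\}_{\lambda\in\mathbb N}$ of generalized quantum circuits over the gate set $\{\mathrm{CNOT},H,T\}$: some input qubits may be initialized to zero and some output qubits may be traced out. It is QPT if the size of $A_\lambda$ (number of gates plus number of input and output qubits) is at most $p(\lambda)$ for some polynomial $p$, and uniform if a deterministic polynomial-time Turing machine outputs the description of $A_\lambda$ on input $1^\lambda$. A non-uniform QPT algorithm is a polynomial-size circuit family, not necessarily uniform, some of whose input qubits are initialized with an arbitrary density matrix $\rho_\lambda$ (quantum advice). Classical outputs are obtained by measuring in the computational basis. A function is negligible if it decays faster than every inverse polynomial. A strong QPRG with output length $\ell$ is a uniform QPT algorithm $G$ such that $G_\lambda$ maps seeds $k\in\{0,1\}^\lambda$ to strings in $\{0,1\}^{\ell(\lambda)}$, $\ell(\lambda)>\lambda$, and: * (pseudodeterminism) there are $c>0$ and $\mu(\lambda)=O(\lambda^{-c})$ such that for every $\lambda$ there is a set $\mathcal K_\lambda\subseteq\{0,1\}^\lambda$ with $\Pr_{k\gets\{0,1\}^\lambda}[k\in\mathcal K_\lambda]\ge 1-\mu(\lambda)$ and $\max_y\Pr[y=G_\lambda(k)]\ge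 1-\mu(\lambda)$ for every $k\in\mathcal K_\lambda$; * (strong security) for every non-uniform QPT distinguisher $A$ there is a negligible $\varepsilon$ such that, for all sufficiently large $\lambda$, $$\bigl|\Pr[A_\lambda(y)=1: k\gets\{0,1\}^\lambda,\ y\gets G_\lambda(k)]-\Pr[A_\lambda(y)=1: y\gets\{0,1\}^{\ell(\lambda)}]\bigr|\le\varepsilon(\lambda).$$ A pseudorandom one-time pad for messages of length $\ell(\lambda)$ is a triple of QPT algorithms $(\mathsf{Gen},\mathsf{Enc},\mathsf{Dec})$, with keys of length $\kappa(\lambda)$ and classical ciphertexts, such that: * (correctness) there is a negligible $\varepsilon$ such that for every $\lambda$ and every $m\in\{0,1\}^{\ell(\lambda)}$, $\Pr[m'=m: k\gets\mathsf{Gen}(1^\lambda),\ c\gets\mathsf{Enc}(1^\lambda,k,m),\ m'\gets\mathsf{Dec}(1^\lambda,k,c)]\ge 1-\varepsilon(\lambda)$; * (stretch) $\ell(\lambda)>\kappa(\lambda)$ for every $\lambda$; * (security) for every non-uniform QPT adversary $A$ there is a negligible $\varepsilon$ such that for every $\lambda$ and all $m_0,m_1\in\{0,1\}^{\ell(\lambda)}$,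 the probabilities of $A_\lambda(c)=1$ for $k\gets\mathsf{Gen}(1^\lambda)$, $c\gets\mathsf{Enc}(1^\lambda,k,m_b)$ with $b=0$ and with $b=1$ differ by at most $\varepsilon(\lambda)$. Theorem. Let $G$ be a strong QPRG with output length $\ell(\lambda)>\lambda^2$ for every $\lambda$. Consider the following scheme. * $\mathsf{Gen}(1^\lambda)$ outputs a uniformly random key $k\in\{0,1\}^{\lambda^2}$, parsed as $k_1\|\cdots\|k_\lambda$ with $k_i\in\{0,1\}^\lambda$. * $\mathsf{Enc}(1^\lambda,k,m)$ computes $c_i=m\oplus G_\lambda(k_i)$ for $i=1,\dots,\lambda$ and outputs $c=c_1\|\cdots\|c_\lambda\in\{0,1\}^{\lambda\ell(\lambda)}$. * $\mathsf{Dec}(1^\lambda,k,c)$ computes $m_i=c_i\oplus G_\lambda(k_i)$, with fresh runs of $G_\lambda$, for $i=1,\dots,\lambda$ and outputs the bitwise majority of $m_1,\dots,m_\lambda$ (this is the string that occurs more than $\lambda/2$ times among the $m_i$, whenever there is one). Then $\mathsf{Gen}$, $\mathsf{Enc}$ and $\mathsf{Dec}$ are realized by QPT algorithms, and the scheme is a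 pseudorandom one-time pad with key length $\lambda^2$ and message length $\ell(\lambda)$; that is, it satisfies correctness, stretch and security. -/

import Mathlib

namespace QCrypto

open scoped BigOperators Matrix ComplexOrder Asymptotics

/-! ### Bit strings -/

/-- The set `{0,1}^n`. -/
abbrev Bits (n : ℕ) : Type := Fin n → Bool

/-- Bitwise exclusive or. -/
def bxor {n : ℕ} (x y : Bits n) : Bits n := fun i => Bool.xor (x i) (y i)

/-- The concatenation `s₁ || … || s_a` of `a` strings of length `b`. -/
def concat {a b : ℕ} (s : Fin a → Bits b) : Bits (a * b) :=
  fun t => s (finProdFinEquiv.symm t).1 (finProdFinEquiv.symm t).2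

/-- The `i`-th block when a string of length `a * b` is parsed as `a` strings of length `b`. -/
def block {a b : ℕ} (s : Bits (a * b)) (i : Fin a) : Bits b :=
  fun j => s (finProdFinEquiv (i, j))

/-- The majority function, applied to each bit position: bit `j` of the output is `1` iff
more than half of the strings have a `1` at position `j`. -/
def maj {a b : ℕ} (s : Fin a → Bits b) : Bits b :=
  fun j => decide (a < 2 * (Finset.univ.filter fun i => s i j = true).card)

/-- If one string occurs more than `a / 2` times among `s₁, …, s_a`, then `maj` returns it. -/
theorem maj_eq_of_majority {a b : ℕ} (s : Fin a → Bits b) (x : Bits b)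
    (h : a < 2 * (Finset.univ.filter fun i => s i = x).card) : maj s = x := by
  funext j
  unfold maj
  cases hx : x j with
  | true =>
    have h1 : (Finset.univ.filter fun i => s i = x).card ≤
        (Finset.univ.filter fun i => s i j = true).card := by
      apply Finset.card_le_card
      intro i hi
      simp only [Finset.mem_filter, Finset.mem_univ, true_and] at hi ⊢
      rw [hi, hx]
    simp only [decide_eq_true_eq]
    omega
  | false =>
    have h1 : Disjoint (Finset.univ.filter fun i => s i = x)
        (Finset.univ.filter fun i => s i j = true) := by
      rw [Finset.disjoint_left]
      intro i hi hi'
      simp only [Finset.mem_filter, Finset.mem_univ, true_and] at hi hi'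
      rw [hi, hx] at hi'
      cases hi'
    have h2 := Finset.card_le_univ ((Finset.univ.filter fun i => s i = x) ∪
        (Finset.univ.filter fun i => s i j = true))
    rw [Finset.card_union_of_disjoint h1, Fintype.card_fin] at h2
    simp only [decide_eq_false_iff_not]
    omega

/-! ### Generalized quantum circuits over the gate set `{CNOT, H, T}` -/

/-- A gate acting on a register of `w` qubits. -/
inductive Gate (w : ℕ) : Type
  | H (i : Fin w) : Gate w
  | T (i : Fin w) : Gate w
  | CNOT (ctrl tgt : Fin w) (hne : ctrl ≠ tgt) : Gate w

/-- The unitary of a gate on `(ℂ²)^{⊗ w}` in the computational basis. -/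
noncomputable def Gate.toMatrix {w : ℕ} : Gate w → Matrix (Bits w) (Bits w) ℂ
  | .H i => Matrix.of fun x y =>
      if ∀ j, j ≠ i → x j = y j then
        (if x i = true ∧ y i = true then -1 else 1) / (Real.sqrt 2 : ℂ)
      else 0
  | .T i => Matrix.diagonal fun x =>
      if x i = true then Complex.exp (Complex.I * (Real.pi / 4)) else 1
  | .CNOT ctrl tgt _ => Matrix.of fun x y =>
      if x = Function.update y tgt (Bool.xor (y tgt) (y ctrl)) then 1 else 0

/-- A generalized quantum circuit with `n` inputs and `m` outputs. It acts on `width` wires. The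
wires outside the range of `inp` are initialized to zero; the wires outside the range of `out` are
traced out at the end. -/
structure QCircuit (n m : ℕ) where
  width : ℕ
  gates : List (Gate width)
  inp : Fin n ↪ Fin width
  out : Fin m ↪ Fin width

namespace QCircuit

variable {n m : ℕ}

/-- The number of gates plus the number of input and output qubits of the unitary part (so that the
zero-initialized and the traced-out qubits are counted as well). -/
def size (C : QCircuit n m) : ℕ := C.gates.length + C.width + C.width

/-- The unitary part; the first gate of the list is applied first. -/
noncomputable def unitaryPart (C : QCircuit n m) : Matrix (Bits C.width) (Bits C.width) ℂ :=
  C.gates.foldl (fun U g => g.toMatrix * U) 1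

/-- The state `ρ` on the input wires, tensored with `|0⟩⟨0|` on all other wires. -/
def initState (C : QCircuit n m) (ρ : Matrix (Bits n) (Bits n) ℂ) :
    Matrix (Bits C.width) (Bits C.width) ℂ :=
  Matrix.of fun x y =>
    if ∀ j, (∀ i, C.inp i ≠ j) → x j = false ∧ y j = false then
      ρ (fun i => x (C.inp i)) (fun i => y (C.inp i))
    else 0

/-- The partial trace over all wires that are not output wires. -/
def traceOut (C : QCircuit n m) (σ : Matrix (Bits C.width) (Bits C.width) ℂ) :
    Matrix (Bits m) (Bits m) ℂ :=
  Matrix.of fun a b => ∑ x : Bits C.width, ∑ y : Bits C.width,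
    if (∀ i, x (C.out i) = a i) ∧ (∀ i, y (C.out i) = b i) ∧
        (∀ j, (∀ i, C.out i ≠ j) → x j = y j) then
      σ x y
    else 0

/-- The quantum channel computed by the circuit. -/
noncomputable def channel (C : QCircuit n m) (ρ : Matrix (Bits n) (Bits n) ℂ) :
    Matrix (Bits m) (Bits m) ℂ :=
  C.traceOut (C.unitaryPart * C.initState ρ * C.unitaryPartᴴ)

/-- `Pr[y = C(x)]` for bit strings `x` and `y`: the circuit is run on `|x⟩⟨x|` and its output is
measured in the computational basis. -/
noncomputable def prob (C : QCircuit n m) (x : Bits n) (y : Bits m) : ℝ :=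
  (C.channel (Matrix.single x x 1) y y).re

end QCircuit

/-! ### Quantum polynomial-time algorithms -/

/-- A quantum algorithm `{A_λ}` is QPT if the size of its circuits is bounded by a polynomial. -/
def IsQPT {a b : ℕ → ℕ} (C : ∀ n, QCircuit (a n) (b n)) : Prop :=
  ∃ p : Polynomial ℕ, ∀ n, (C n).size ≤ p.eval n

/-- The alphabet in which circuits are described. -/
inductive DescSymbol : Type
  | tick | sep | h | t | cnot

/-- Unary description of a natural number, with an end marker. -/
def descNat (k : ℕ) : List DescSymbol := List.replicate k .tick ++ [.sep]

/-- Description of a gate: its type and the wires it acts on. -/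
def Gate.desc {w : ℕ} : Gate w → List DescSymbol
  | .H i => .h :: descNat i
  | .T i => .t :: descNat i
  | .CNOT ctrl tgt _ => .cnot :: (descNat ctrl ++ descNat tgt)

/-- Description of a circuit: numbers of inputs, of outputs and of wires, the input wires, the
output wires, the gates. -/
def QCircuit.desc {n m : ℕ} (C : QCircuit n m) : List DescSymbol :=
  descNat n ++ descNat m ++ descNat C.width ++
    (List.ofFn fun i => descNat (C.inp i)).flatten ++
    (List.ofFn fun i => descNat (C.out i)).flatten ++
    (C.gates.map Gate.desc).flatten

/-- A family of circuits is uniform if a deterministic polynomial-time Turing machine outputs the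
description of the `λ`-th circuit on input `1^λ`. -/
def IsUniform {a b : ℕ → ℕ} (C : ∀ n, QCircuit (a n) (b n)) : Prop :=
  Nonempty (Turing.TM2ComputableInPolyTime Computability.unaryEncodeNat
    (id : List DescSymbol → List DescSymbol) fun n => (C n).desc)

/-- Density matrices on `a` qubits. -/
def IsDensity {a : ℕ} (ρ : Matrix (Bits a) (Bits a) ℂ) : Prop :=
  ρ.PosSemidef ∧ ρ.trace = 1

/-- A non-uniform QPT algorithm `{(A_λ, ρ_λ)}` that gets a string of length `d λ` and outputs one
bit: a polynomial-size family of circuits, where the input qubits of `A_λ` after the first `d λ` are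
initialized with the density matrix `ρ_λ`. -/
structure Adversary (d : ℕ → ℕ) where
  adviceLen : ℕ → ℕ
  circuit : ∀ n, QCircuit (d n + adviceLen n) 1
  advice : ∀ n, Matrix (Bits (adviceLen n)) (Bits (adviceLen n)) ℂ
  isQPT : IsQPT circuit
  isDensity : ∀ n, IsDensity (advice n)

/-- The product state `|x⟩⟨x| ⊗ ρ`. -/
def withAdvice {d a : ℕ} (x : Bits d) (ρ : Matrix (Bits a) (Bits a) ℂ) :
    Matrix (Bits (d + a)) (Bits (d + a)) ℂ :=
  Matrix.of fun u v =>
    (Matrix.single x x 1 : Matrix (Bits d) (Bits d) ℂ)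
        (fun i => u (Fin.castAdd a i)) (fun i => v (Fin.castAdd a i)) *
      ρ (fun i => u (Fin.natAdd d i)) (fun i => v (Fin.natAdd d i))

/-- `Pr[A_λ(x) = 1]`. -/
noncomputable def Adversary.accept {d : ℕ → ℕ} (A : Adversary d) (n : ℕ) (x : Bits (d n)) : ℝ :=
  ((A.circuit n).channel (withAdvice x (A.advice n)) (fun _ => true) (fun _ => true)).re

/-- Negligible functions of the security parameter. -/
def Negligible (ε : ℕ → ℝ) : Prop :=
  Asymptotics.SuperpolynomialDecay Filter.atTop (fun n : ℕ => (n : ℝ)) ε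

/-! ### Strong pseudodeterministic quantum pseudorandom generators -/

/-- `G` has pseudodeterminism `1 - μ`. -/
def Pseudodeterministic {ℓ : ℕ → ℕ} (G : ∀ n, QCircuit n (ℓ n)) (μ : ℕ → ℝ) : Prop :=
  ∀ n, ∃ K : Finset (Bits n),
    1 - μ n ≤ (K.card : ℝ) / 2 ^ n ∧
    ∀ k ∈ K, ∃ y : Bits (ℓ n), 1 - μ n ≤ (G n).prob k y

/-- `Pr[A_λ(y) = 1 : k ← {0,1}^λ, y ← G_λ(k)]`. -/
noncomputable def prgReal {ℓ : ℕ → ℕ} (G : ∀ n, QCircuit n (ℓ n)) (A : Adversary ℓ) (n : ℕ) : ℝ :=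
  ∑ k : Bits n, (1 / 2 ^ n : ℝ) * ∑ y : Bits (ℓ n), (G n).prob k y * A.accept n y

/-- `Pr[A_λ(y) = 1 : y ← {0,1}^ℓ(λ)]`. -/
noncomputable def prgIdeal {ℓ : ℕ → ℕ} (A : Adversary ℓ) (n : ℕ) : ℝ :=
  ∑ y : Bits (ℓ n), (1 / 2 ^ ℓ n : ℝ) * A.accept n y

/-- Strong pseudodeterministic quantum pseudorandom generators with seed length `λ` and output
length `ℓ λ`. (Weak security, a distinguishing advantage of at most `1 - 1 / poly`, is a special
case of strong security.) -/
structure IsStrongQPRG {ℓ : ℕ → ℕ} (G : ∀ n, QCircuit n (ℓ n)) : Prop where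
  isQPT : IsQPT G
  isUniform : IsUniform G
  pseudodeterminism : ∃ c : ℝ, 0 < c ∧ ∃ μ : ℕ → ℝ,
    μ =O[Filter.atTop] (fun n : ℕ => (n : ℝ) ^ (-c)) ∧ Pseudodeterministic G μ
  stretch : ∀ n, n < ℓ n
  strongSecurity : ∀ A : Adversary ℓ, ∃ ε : ℕ → ℝ, Negligible ε ∧
    ∀ᶠ n in Filter.atTop, |prgReal G A n - prgIdeal A n| ≤ ε n

/-! ### Pseudorandom one-time pads -/

/-- Circuit families `(Gen, Enc, Dec)` with keys of length `κ λ`, messages of length `ℓ λ` and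
classical ciphertexts of length `γ λ`. The input of `Enc` is `k || m`, that of `Dec` is `k || c`. -/
structure EncScheme (κ ℓ γ : ℕ → ℕ) where
  Gen : ∀ n, QCircuit 0 (κ n)
  Enc : ∀ n, QCircuit (κ n + ℓ n) (γ n)
  Dec : ∀ n, QCircuit (κ n + γ n) (ℓ n)

namespace EncScheme

variable {κ ℓ γ : ℕ → ℕ}

/-- `Pr[k = Gen(1^λ)]`. -/
noncomputable def genProb (S : EncScheme κ ℓ γ) (n : ℕ) (k : Bits (κ n)) : ℝ :=
  (S.Gen n).prob Fin.elim0 k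

/-- `Pr[c = Enc(1^λ, k, m)]`. -/
noncomputable def encProb (S : EncScheme κ ℓ γ) (n : ℕ) (k : Bits (κ n)) (m : Bits (ℓ n))
    (c : Bits (γ n)) : ℝ :=
  (S.Enc n).prob (Fin.append k m) c

/-- `Pr[m = Dec(1^λ, k, c)]`. -/
noncomputable def decProb (S : EncScheme κ ℓ γ) (n : ℕ) (k : Bits (κ n)) (c : Bits (γ n))
    (m : Bits (ℓ n)) : ℝ :=
  (S.Dec n).prob (Fin.append k c) m

/-- `Pr[m = m' : k ← Gen(1^λ), c ← Enc(1^λ, k, m), m' ← Dec(1^λ, k, c)]`. -/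
noncomputable def correctProb (S : EncScheme κ ℓ γ) (n : ℕ) (m : Bits (ℓ n)) : ℝ :=
  ∑ k : Bits (κ n), S.genProb n k * ∑ c : Bits (γ n), S.encProb n k m c * S.decProb n k c m

/-- `Pr[A_λ(c) = 1 : k ← Gen(1^λ), c ← Enc(1^λ, k, m)]`. -/
noncomputable def acceptProb (S : EncScheme κ ℓ γ) (A : Adversary γ) (n : ℕ) (m : Bits (ℓ n)) : ℝ :=
  ∑ k : Bits (κ n), S.genProb n k * ∑ c : Bits (γ n), S.encProb n k m c * A.accept n c

/-- Pseudorandom one-time pads. -/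
structure IsPOTP (S : EncScheme κ ℓ γ) : Prop where
  genQPT : IsQPT S.Gen
  encQPT : IsQPT S.Enc
  decQPT : IsQPT S.Dec
  correctness : ∃ ε : ℕ → ℝ, Negligible ε ∧
    ∀ (n : ℕ) (m : Bits (ℓ n)), 1 - ε n ≤ S.correctProb n m
  stretch : ∀ n, κ n < ℓ n
  security : ∀ A : Adversary γ, ∃ ε : ℕ → ℝ, Negligible ε ∧
    ∀ (n : ℕ) (m₀ m₁ : Bits (ℓ n)), |S.acceptProb A n m₀ - S.acceptProb A n m₁| ≤ ε n

end EncScheme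

/-- The probability that independent runs of `G_λ` on the blocks `k₁, …, k_λ` of the key `k` output
`y₁, …, y_λ`. -/
noncomputable def parallelProb {ℓ : ℕ → ℕ} (G : ∀ n, QCircuit n (ℓ n)) (n : ℕ) (k : Bits (n * n))
    (y : Fin n → Bits (ℓ n)) : ℝ :=
  ∏ i, (G n).prob (block k i) (y i)

/-- The scheme realizes the parallel-repetition construction from `G`:
* `Gen` outputs a uniformly random key `k = k₁ || … || k_λ` of `λ²` bits;
* `Enc` runs `y_i ← G_λ(k_i)` for every `i` and outputs `(m ⊕ y₁) || … || (m ⊕ y_λ)`;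
* `Dec` parses the ciphertext as `c₁ || … || c_λ`, runs `y_i ← G_λ(k_i)` afresh for every `i` and
  outputs the majority of `c₁ ⊕ y₁, …, c_λ ⊕ y_λ`. -/
structure RealizesConstruction {ℓ : ℕ → ℕ} (G : ∀ n, QCircuit n (ℓ n))
    (S : EncScheme (fun n => n * n) ℓ (fun n => n * ℓ n)) : Prop where
  gen : ∀ (n : ℕ) (k : Bits (n * n)), S.genProb n k = 1 / 2 ^ (n * n)
  enc : ∀ (n : ℕ) (k : Bits (n * n)) (m : Bits (ℓ n)) (c : Bits (n * ℓ n)),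
    S.encProb n k m c =
      ∑ y : Fin n → Bits (ℓ n),
        if (concat fun i => bxor m (y i)) = c then parallelProb G n k y else 0
  dec : ∀ (n : ℕ) (k : Bits (n * n)) (c : Bits (n * ℓ n)) (m : Bits (ℓ n)),
    S.decProb n k c m =
      ∑ y : Fin n → Bits (ℓ n),
        if (maj fun i => bxor (block c i) (y i)) = m then parallelProb G n k y else 0

end QCrypto

namespace QCrypto

open scoped BigOperators Matrix ComplexOrder Asymptotics ComplexConjugate

/-! ### Gates on an arbitrary set of wires, acting on state vectors -/

/-! Realizability. Every circuit needed runs copies of a given circuit on disjoint wires and then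
computes a classical function reversibly. A reversible map that is realized on basis states without
phases only relabels the final measurement outcomes, so the outcome probabilities of the copies
multiply (`parallel_prob`). CNOT and a Toffoli gate built from H, T and CNOT suffice for the
classical part. Encryption adds the message to the output wires (`exists_enc_circuit`); decryption
adds the outputs to the ciphertext and takes the majority by unary counting (`exists_dec_circuit`).
Since only measured outcomes matter, the diagonal of the output state is enough, and it is a linear
functional of the input state (`QCircuit.channel_diag`).

Correctness. For a fixed key, block `i` decrypts to `m` whenever the two runs of `G` on `k_i` agree,
and the pairs of runs are independent over `i`. Decryption can fail only if at most half of the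
pairs agree. Giving weight 1/8 to an agreeing pair and 8 to a disagreeing one, the failure indicator
is at most the product of the weights, and the expectation of the product is the `n`-th power of the
expected weight of one block (`RealizesConstruction.correctProb_ge`). Once pseudodeterminism is at
least 63/64, that expected weight is at most 1/2, so the error is at most `2^{-n}`.

Security. The blocks of the ciphertext are `m` plus independent samples of the output distribution
of `G` on a random seed. A hybrid argument (`hybrid_bound`) replaces these by uniform strings one at
a time, and uniform blocks hide `m` completely. A distinguisher for one replacement receives all the
other blocks as advice, in the form of a diagonal density matrix tensored with the advice of the
adversary; it only adds its challenge to one block and runs the adversary (`exists_distinguisher`).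
Non-uniformity also lets it use the best message and the best position for each security parameter,
so a single application of strong security covers all messages and positions, with total loss `2n`.
-/

/-- A gate on wires labelled by `W`. -/
inductive WGate (W : Type) : Type
  | H (i : W) : WGate W
  | T (i : W) : WGate W
  | CNOT (ctrl tgt : W) (hne : ctrl ≠ tgt) : WGate W

/-- The primitive eighth root of unity in the `T` gate. -/
noncomputable def omega8 : ℂ := Complex.exp (Complex.I * (Real.pi / 4))

/-- State vectors on the wires `W`. -/
abbrev Amp (W : Type) : Type := (W → Bool) → ℂ

theorem extend_comp_self {V W : Type} (e : V ↪ W) (x : W → Bool) : Function.extend e (x ∘ e) x = x := by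
  funext w
  by_cases h : ∃ j, e j = w
  · obtain ⟨j, rfl⟩ := h
    rw [e.injective.extend_apply]; rfl
  · rw [Function.extend_apply' _ _ _ h]

theorem extend_extend {V W : Type} (e : V ↪ W) (x : W → Bool) (u u' : V → Bool) :
    Function.extend e u (Function.extend e u' x) = Function.extend e u x := by
  funext w
  by_cases h : ∃ j, e j = w
  · obtain ⟨j, rfl⟩ := h
    simp only [e.injective.extend_apply]
  · simp only [Function.extend_apply' _ _ _ h]

theorem extend_comp_embedding {V W : Type} (e : V ↪ W) (x : W → Bool) (u : V → Bool) :
    Function.extend e u x ∘ e = u := by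
  funext j
  simp [e.injective.extend_apply]

section Act

variable {V W : Type} [DecidableEq V] [DecidableEq W]

/-- The action of a gate on a state vector. -/
noncomputable def WGate.act : WGate W → Amp W → Amp W
  | .H i, ψ => fun x =>
      (ψ (Function.update x i false) + (if x i then -1 else 1) * ψ (Function.update x i true)) /
        (Real.sqrt 2 : ℂ)
  | .T i, ψ => fun x => (if x i then omega8 else 1) * ψ x
  | .CNOT c t _, ψ => fun x => ψ (Function.update x t (Bool.xor (x t) (x c)))

/-- The action of a list of gates, the first gate being applied first. -/
noncomputable def act (L : List (WGate W)) (ψ : Amp W) : Amp W := L.foldl (fun φ g => g.act φ) ψ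

@[simp] theorem act_nil (ψ : Amp W) : act [] ψ = ψ := rfl

@[simp] theorem act_cons (g : WGate W) (L : List (WGate W)) (ψ : Amp W) :
    act (g :: L) ψ = act L (g.act ψ) := rfl

theorem act_append (L L' : List (WGate W)) (ψ : Amp W) :
    act (L ++ L') ψ = act L' (act L ψ) := by
  simp [act, List.foldl_append]

theorem WGate.act_const_mul (g : WGate W) (a : ℂ) (ψ : Amp W) :
    g.act (fun x => a * ψ x) = fun x => a * g.act ψ x := by
  cases g <;> funext x <;> simp only [WGate.act] <;> ring

theorem act_const_mul (L : List (WGate W)) (a : ℂ) (ψ : Amp W) :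
    act L (fun x => a * ψ x) = fun x => a * act L ψ x := by
  induction L generalizing ψ with
  | nil => rfl
  | cons g L ih => simp only [act_cons, WGate.act_const_mul, ih]

/-- Relabelling of wires. -/
def WGate.map (e : V ↪ W) : WGate V → WGate W
  | .H i => .H (e i)
  | .T i => .T (e i)
  | .CNOT c t h => .CNOT (e c) (e t) (e.injective.ne h)

theorem extend_update_comp (e : V ↪ W) (x : W → Bool) (i : V) (b : Bool) :
    Function.extend e (Function.update (x ∘ e) i b) x = Function.update x (e i) b := by
  funext w
  by_cases h : ∃ j, e j = w
  · obtain ⟨j, rfl⟩ := h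
    rw [e.injective.extend_apply]
    by_cases hj : j = i
    · subst hj; simp
    · rw [Function.update_of_ne hj, Function.update_of_ne (e.injective.ne hj)]; rfl
  · rw [Function.extend_apply' _ _ _ h, Function.update_of_ne]
    rintro rfl
    exact h ⟨i, rfl⟩

theorem WGate.act_map (e : V ↪ W) (g : WGate V) (ψ : Amp W) (x : W → Bool) :
    (g.map e).act ψ x = g.act (fun u => ψ (Function.extend e u x)) (x ∘ e) := by
  cases g with
  | H i => simp only [WGate.map, WGate.act, extend_update_comp]; rfl
  | T i => simp only [WGate.map, WGate.act, extend_comp_self]; rfl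
  | CNOT c t h => simp only [WGate.map, WGate.act, extend_update_comp]; rfl

/-- A circuit applied to a subset of the wires acts on each slice of the state vector. -/
theorem act_map (e : V ↪ W) (L : List (WGate V)) (ψ : Amp W) (x : W → Bool) :
    act (L.map (WGate.map e)) ψ x = act L (fun u => ψ (Function.extend e u x)) (x ∘ e) := by
  induction L generalizing ψ with
  | nil => simp only [List.map_nil, act_nil, extend_comp_self]
  | cons g L ih =>
    rw [List.map_cons, act_cons, act_cons, ih]
    congr 1
    funext u
    rw [WGate.act_map, extend_comp_embedding]
    simp only [extend_extend]

/-! ### Unitarity of the gates -/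

theorem normSq_omega8 : Complex.normSq omega8 = 1 := by
  have h : omega8 = Complex.exp ((Real.pi / 4 : ℝ) * Complex.I) := by
    unfold omega8; congr 1; push_cast; ring
  rw [h, Complex.normSq_eq_norm_sq, Complex.norm_exp_ofReal_mul_I, one_pow]

theorem normSq_sqrt_two : Complex.normSq (Real.sqrt 2 : ℂ) = 2 := by
  rw [Complex.normSq_ofReal, Real.mul_self_sqrt (by norm_num)]

/-- Negation of one bit. -/
def flipBit (i : W) : Equiv.Perm (W → Bool) where
  toFun x := Function.update x i (!x i)
  invFun x := Function.update x i (!x i)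
  left_inv x := by simp
  right_inv x := by simp

/-- Adding one bit to another. -/
def cnotPerm (c t : W) (h : c ≠ t) : Equiv.Perm (W → Bool) where
  toFun x := Function.update x t (Bool.xor (x t) (x c))
  invFun x := Function.update x t (Bool.xor (x t) (x c))
  left_inv x := by simp [Function.update_of_ne h]
  right_inv x := by simp [Function.update_of_ne h]

/-- H mixes only the two amplitudes that differ in bit `i`, where the parallelogram law applies; T
multiplies by phases; CNOT permutes the basis. -/
theorem WGate.sum_normSq_act [Fintype W] (g : WGate W) (ψ : Amp W) :
    ∑ x, Complex.normSq (g.act ψ x) = ∑ x, Complex.normSq (ψ x) := by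
  cases g with
  | H i =>
    -- Doubling the sum groups each string with its flip, without choosing representatives of the
    -- pairs.
    have key : ∀ F : (W → Bool) → ℝ, 2 * ∑ x, F x = ∑ x, (F x + F (flipBit i x)) := by
      intro F
      rw [Finset.sum_add_distrib, Equiv.sum_comp (flipBit i) F, two_mul]
    have h2 : (2 : ℝ) ≠ 0 := by norm_num
    apply mul_left_cancel₀ h2
    rw [key, key]
    refine Finset.sum_congr rfl fun x _ => ?_
    have par : ∀ a b : ℂ, Complex.normSq ((a + b) / (Real.sqrt 2 : ℂ)) +
        Complex.normSq ((a - b) / (Real.sqrt 2 : ℂ)) = Complex.normSq a + Complex.normSq b := by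
      intro a b
      rw [map_div₀, map_div₀, normSq_sqrt_two, Complex.normSq_add, Complex.normSq_sub]
      ring
    have hx : x = Function.update x i (x i) := (Function.update_eq_self i x).symm
    cases hb : x i with
    | false =>
      rw [hb] at hx
      have := par (ψ (Function.update x i false)) (ψ (Function.update x i true))
      simp only [WGate.act, flipBit, Equiv.coe_fn_mk, hb, Function.update_idem,
        Function.update_self, Bool.not_false]
      rw [← hx] at this ⊢
      simpa [sub_eq_add_neg] using this
    | true =>
      rw [hb] at hx
      have := par (ψ (Function.update x i false)) (ψ (Function.update x i true))
      simp only [WGate.act, flipBit, Equiv.coe_fn_mk, hb, Function.update_idem,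
        Function.update_self, Bool.not_true]
      rw [← hx] at this ⊢
      rw [add_comm, add_comm (Complex.normSq (ψ x))]
      simpa [sub_eq_add_neg] using this
  | T i =>
    refine Finset.sum_congr rfl fun x _ => ?_
    simp only [WGate.act, map_mul]
    split_ifs <;> simp [normSq_omega8]
  | CNOT c t h => exact Equiv.sum_comp (cnotPerm c t h) fun x => Complex.normSq (ψ x)

theorem sum_normSq_act [Fintype W] (L : List (WGate W)) (ψ : Amp W) :
    ∑ x, Complex.normSq (act L ψ x) = ∑ x, Complex.normSq (ψ x) := by
  induction L generalizing ψ with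
  | nil => rfl
  | cons g L ih => rw [act_cons, ih, WGate.sum_normSq_act]

end Act

/-! ### Circuits on an arbitrary set of wires -/

/-- The basis vector `|u⟩`. -/
noncomputable def ket {W : Type} (u : W → Bool) : Amp W :=
  open Classical in fun v => if v = u then 1 else 0

/-- The string `s` on the wires in the range of `inp`, zero on all other wires. -/
noncomputable def initBits {n : ℕ} {W : Type} (inp : Fin n ↪ W) (s : Bits n) : W → Bool :=
  Function.extend inp s fun _ => false

theorem initBits_apply {n : ℕ} {W : Type} (inp : Fin n ↪ W) (s : Bits n) (i : Fin n) :
    initBits inp s (inp i) = s i := inp.injective.extend_apply _ _ _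

theorem initBits_of_notMem {n : ℕ} {W : Type} (inp : Fin n ↪ W) (s : Bits n) (w : W)
    (h : ∀ i, inp i ≠ w) : initBits inp s w = false :=
  Function.extend_apply' _ _ _ fun ⟨i, hi⟩ => h i hi

theorem eq_initBits_iff {n : ℕ} {W : Type} (inp : Fin n ↪ W) (s : Bits n) (u : W → Bool) :
    u = initBits inp s ↔ (fun i => u (inp i)) = s ∧ ∀ w, (∀ i, inp i ≠ w) → u w = false := by
  constructor
  · rintro rfl
    exact ⟨funext fun i => initBits_apply inp s i, fun w h => initBits_of_notMem inp s w h⟩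
  · rintro ⟨rfl, h⟩
    funext w
    by_cases hw : ∃ i, inp i = w
    · obtain ⟨i, rfl⟩ := hw
      rw [initBits_apply]
    · have hw' : ∀ i, inp i ≠ w := fun i hi => hw ⟨i, hi⟩
      rw [initBits_of_notMem _ _ _ hw', h w hw']

/-- The matrix of the linear functional that maps an input state to the probability that the
outcome of the measurement of the output wires is `y`. -/
noncomputable def outcomeMatrix {n m : ℕ} {W : Type} [Fintype W] [DecidableEq W]
    (L : List (WGate W)) (inp : Fin n ↪ W) (out : Fin m ↪ W) (y : Bits m) (s t : Bits n) : ℂ :=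
  ∑ v : W → Bool, if ∀ i, v (out i) = y i then
    act L (ket (initBits inp s)) v * conj (act L (ket (initBits inp t)) v) else 0

/-- The gate as a gate on the wires `Fin w`. -/
def Gate.toWGate {w : ℕ} : Gate w → WGate (Fin w)
  | .H i => .H i
  | .T i => .T i
  | .CNOT c t h => .CNOT c t h

/-- The converse of `Gate.toWGate`. -/
def WGate.toGate {w : ℕ} : WGate (Fin w) → Gate w
  | .H i => .H i
  | .T i => .T i
  | .CNOT c t h => .CNOT c t h

theorem WGate.toWGate_toGate {w : ℕ} (g : WGate (Fin w)) : g.toGate.toWGate = g := by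
  cases g <;> rfl

theorem Gate.mulVec_eq_act {w : ℕ} (g : Gate w) (ψ : Amp (Fin w)) :
    g.toMatrix *ᵥ ψ = g.toWGate.act ψ := by
  funext x
  cases g with
  | H i =>
    simp only [Gate.toMatrix, Gate.toWGate, WGate.act, Matrix.mulVec, dotProduct, Matrix.of_apply]
    -- Row `x` of the matrix of H vanishes outside these two columns.
    rw [Fintype.sum_eq_add (Function.update x i false) (Function.update x i true)]
    · have h : ∀ b, ∀ j, j ≠ i → x j = Function.update x i b j :=
        fun b j hj => (Function.update_of_ne hj _ _).symm
      rw [if_pos (h false), if_pos (h true)]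
      cases x i <;> simp <;> ring
    · intro h
      have := congrFun h i
      simp at this
    · rintro y ⟨h0, h1⟩
      rw [if_neg, zero_mul]
      intro h
      have hy : y = Function.update x i (y i) := by
        funext j
        by_cases hj : j = i
        · subst hj; simp
        · rw [Function.update_of_ne hj, h j hj]
      cases hb : y i with
      | false => rw [hb] at hy; exact h0 hy
      | true => rw [hb] at hy; exact h1 hy
  | T i =>
    simp only [Gate.toMatrix, Gate.toWGate, WGate.act, Matrix.mulVec_diagonal, omega8]
  | CNOT c t h =>
    simp only [Gate.toMatrix, Gate.toWGate, WGate.act, Matrix.mulVec, dotProduct, Matrix.of_apply]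
    have : ∀ y, x = Function.update y t (Bool.xor (y t) (y c)) ↔
        y = Function.update x t (Bool.xor (x t) (x c)) :=
      fun y => ((cnotPerm c t h).symm_apply_eq (x := x) (y := y)).symm.trans eq_comm
    simp [this]

namespace QCircuit

variable {n m : ℕ}

/-- The gates of a circuit. -/
def wgates (C : QCircuit n m) : List (WGate (Fin C.width)) := C.gates.map Gate.toWGate

theorem unitaryPart_mulVec (C : QCircuit n m) (ψ : Amp (Fin C.width)) :
    C.unitaryPart *ᵥ ψ = act C.wgates ψ := by
  have h : ∀ (L : List (Gate C.width)) (M : Matrix (Bits C.width) (Bits C.width) ℂ),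
      L.foldl (fun U g => g.toMatrix * U) M *ᵥ ψ = act (L.map Gate.toWGate) (M *ᵥ ψ) := by
    intro L
    induction L with
    | nil => intro M; rfl
    | cons g L ih =>
      intro M
      rw [List.foldl_cons, ih, List.map_cons, act_cons, ← Matrix.mulVec_mulVec,
        Gate.mulVec_eq_act]
  rw [unitaryPart, h, Matrix.one_mulVec]; rfl

theorem unitaryPart_apply (C : QCircuit n m) (x u : Bits C.width) :
    C.unitaryPart x u = act C.wgates (ket u) x := by
  have : (ket u : Amp (Fin C.width)) = Pi.single u 1 := by
    funext v
    simp [ket, Pi.single_apply]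
  rw [← unitaryPart_mulVec, this, Matrix.mulVec_single_one]; rfl

theorem initState_apply (C : QCircuit n m) (ρ : Matrix (Bits n) (Bits n) ℂ)
    (u v : Bits C.width) :
    C.initState ρ u v = ∑ s, ∑ t, ρ s t *
      ((if u = initBits C.inp s then 1 else 0) * (if v = initBits C.inp t then 1 else 0)) := by
  simp only [initState, Matrix.of_apply, eq_initBits_iff]
  rw [Finset.sum_eq_single (fun i => u (C.inp i)), Finset.sum_eq_single (fun i => v (C.inp i))]
  · by_cases h : (∀ w, (∀ i, C.inp i ≠ w) → u w = false) <;>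
    by_cases h' : (∀ w, (∀ i, C.inp i ≠ w) → v w = false)
    · rw [if_pos fun j hj => ⟨h j hj, h' j hj⟩, if_pos ⟨rfl, h⟩, if_pos ⟨rfl, h'⟩, mul_one, mul_one]
    · rw [if_neg fun H => h' fun j hj => (H j hj).2]; simp [h']
    · rw [if_neg fun H => h fun j hj => (H j hj).1]; simp [h]
    · rw [if_neg fun H => h fun j hj => (H j hj).1]; simp [h]
  · intro t _ ht; simp [ht.symm]
  · simp
  · intro t _ ht; simp [ht.symm]
  · simp

/-- On the diagonal the two full strings agree on the output wires as well as on the traced-out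
wires, so the double sum collapses. -/
theorem traceOut_diag (C : QCircuit n m) (σ : Matrix (Bits C.width) (Bits C.width) ℂ)
    (y : Bits m) :
    C.traceOut σ y y = ∑ x, if ∀ i, x (C.out i) = y i then σ x x else 0 := by
  simp only [traceOut, Matrix.of_apply]
  refine Finset.sum_congr rfl fun x _ => ?_
  rw [Finset.sum_eq_single x]
  · simp
  · intro z _ hz
    rw [if_neg]
    rintro ⟨h1, h2, h3⟩
    apply hz
    funext j
    by_cases hj : ∃ i, C.out i = j
    · obtain ⟨i, rfl⟩ := hj
      rw [h1, h2]
    · exact (h3 j fun i hi => hj ⟨i, hi⟩).symm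
  · simp

theorem channel_diag (C : QCircuit n m) (ρ : Matrix (Bits n) (Bits n) ℂ) (y : Bits m) :
    C.channel ρ y y = ∑ s, ∑ t, ρ s t * outcomeMatrix C.wgates C.inp C.out y s t := by
  have hσ : ∀ x, (C.unitaryPart * C.initState ρ * C.unitaryPartᴴ) x x =
      ∑ s, ∑ t, ρ s t * (act C.wgates (ket (initBits C.inp s)) x *
        conj (act C.wgates (ket (initBits C.inp t)) x)) := by
    intro x
    simp only [Matrix.mul_apply, Matrix.conjTranspose_apply, initState_apply, Finset.sum_mul,
      Finset.mul_sum]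
    rw [Finset.sum_comm]
    simp_rw [Finset.sum_comm (s := Finset.univ (α := Bits C.width)) (t := Finset.univ (α := Bits n))]
    refine Finset.sum_congr rfl fun s _ => Finset.sum_congr rfl fun t _ => ?_
    rw [Finset.sum_eq_single (initBits C.inp s), Finset.sum_eq_single (initBits C.inp t)]
    · simp only [unitaryPart_apply]
      simp only [if_true, RCLike.star_def]
      ring
    · intro v _ hv; simp [hv]
    · simp
    · intro v _ hv; simp [hv]
    · simp
  simp only [channel, traceOut_diag, hσ, outcomeMatrix, Finset.mul_sum]
  simp_rw [mul_ite, mul_zero]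
  rw [Finset.sum_congr rfl fun s _ => Finset.sum_comm, Finset.sum_comm]
  refine Finset.sum_congr rfl fun x _ => ?_
  split_ifs <;> simp

end QCircuit

/-- The circuit with wires `W` and gates `L`. -/
noncomputable def circuitOf {n m : ℕ} {W : Type} [Fintype W] (L : List (WGate W))
    (inp : Fin n ↪ W) (out : Fin m ↪ W) : QCircuit n m where
  width := Fintype.card W
  gates := L.map fun g => (g.map (Fintype.equivFin W).toEmbedding).toGate
  inp := inp.trans (Fintype.equivFin W).toEmbedding
  out := out.trans (Fintype.equivFin W).toEmbedding

theorem circuitOf_size {n m : ℕ} {W : Type} [Fintype W] (L : List (WGate W))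
    (inp : Fin n ↪ W) (out : Fin m ↪ W) :
    (circuitOf L inp out).size = L.length + Fintype.card W + Fintype.card W := by
  simp [circuitOf, QCircuit.size]

/-- Measurement statistics do not depend on how wires are numbered. This allows circuits to be
designed on structured wire types such as sums and products. -/
theorem circuitOf_channel_diag {n m : ℕ} {W : Type} [Fintype W] [DecidableEq W]
    (L : List (WGate W)) (inp : Fin n ↪ W) (out : Fin m ↪ W) (ρ : Matrix (Bits n) (Bits n) ℂ)
    (y : Bits m) :
    (circuitOf L inp out).channel ρ y y = ∑ s, ∑ t, ρ s t * outcomeMatrix L inp out y s t := by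
  rw [QCircuit.channel_diag]
  refine Finset.sum_congr rfl fun s _ => Finset.sum_congr rfl fun t _ => ?_
  congr 1
  set e := Fintype.equivFin W with he
  have hw : (circuitOf L inp out).wgates = L.map (WGate.map e.toEmbedding) := by
    simp [circuitOf, QCircuit.wgates, WGate.toWGate_toGate, he]
  have hk : ∀ (s : Bits n) (x : Bits (Fintype.card W)),
      act (L.map (WGate.map e.toEmbedding)) (ket (initBits (inp.trans e.toEmbedding) s)) x =
        act L (ket (initBits inp s)) (x ∘ e) := by
    intro s x
    rw [act_map]
    congr 1
    funext u
    have h1 : Function.extend e.toEmbedding u x = u ∘ e.symm := by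
      funext j
      obtain ⟨w, rfl⟩ := e.surjective j
      rw [show e w = e.toEmbedding w from rfl, e.toEmbedding.injective.extend_apply]
      simp
    have h2 : u ∘ e.symm = initBits (inp.trans e.toEmbedding) s ↔ u = initBits inp s := by
      rw [eq_initBits_iff, eq_initBits_iff]
      refine and_congr (by simp) ⟨fun h w hw => ?_, fun h w hw => ?_⟩
      · simpa using h (e w) (by simpa using hw)
      · exact h (e.symm w) fun i hi => hw i (by simp [hi])
    unfold ket
    rw [h1]
    by_cases h : u = initBits inp s
    · rw [if_pos (h2.2 h), if_pos h]
    · rw [if_neg (mt h2.1 h), if_neg h]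
  have hO : outcomeMatrix (circuitOf L inp out).wgates (circuitOf L inp out).inp
      (circuitOf L inp out).out y s t = outcomeMatrix (L.map (WGate.map e.toEmbedding))
        (inp.trans e.toEmbedding) (out.trans e.toEmbedding) y s t := by
    rw [hw]; rfl
  rw [hO]
  unfold outcomeMatrix
  refine Fintype.sum_equiv (Equiv.arrowCongr e.symm (Equiv.refl Bool)) _ _ fun x => ?_
  rw [hk, hk]
  rfl

/-! ### Outcome probabilities -/

/-- The probability that running `L` on the basis state `u` and measuring all wires gives `v`. -/
noncomputable def transProb {W : Type} [DecidableEq W] (L : List (WGate W)) (u v : W → Bool) : ℝ :=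
  Complex.normSq (act L (ket u) v)

theorem sum_transProb {W : Type} [Fintype W] [DecidableEq W] (L : List (WGate W)) (u : W → Bool) :
    ∑ v, transProb L u v = 1 := by
  unfold transProb
  rw [sum_normSq_act, Finset.sum_eq_single u]
  · simp [ket]
  · intro v _ hv; simp [ket, hv]
  · simp

theorem outcomeMatrix_diag {n m : ℕ} {W : Type} [Fintype W] [DecidableEq W]
    (L : List (WGate W)) (inp : Fin n ↪ W) (out : Fin m ↪ W) (y : Bits m) (s : Bits n) :
    outcomeMatrix L inp out y s s =
      ((∑ v, if ∀ i, v (out i) = y i then transProb L (initBits inp s) v else 0 : ℝ) : ℂ) := by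
  simp only [outcomeMatrix, transProb]
  push_cast
  refine Finset.sum_congr rfl fun v _ => ?_
  split_ifs <;> simp [Complex.mul_conj]

theorem sum_single_mul {n : ℕ} (x : Bits n) (f : Bits n → Bits n → ℂ) :
    ∑ s, ∑ t, (Matrix.single x x 1 : Matrix (Bits n) (Bits n) ℂ) s t * f s t = f x x := by
  rw [Finset.sum_eq_single x, Finset.sum_eq_single x]
  · simp
  · intro t _ ht; simp [ht.symm]
  · simp
  · intro t _ ht; simp [ht.symm]
  · simp

theorem QCircuit.prob_eq {n m : ℕ} (C : QCircuit n m) (x : Bits n) (y : Bits m) :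
    C.prob x y =
      ∑ v, if ∀ i, v (C.out i) = y i then transProb C.wgates (initBits C.inp x) v else 0 := by
  rw [QCircuit.prob, QCircuit.channel_diag, sum_single_mul, outcomeMatrix_diag, Complex.ofReal_re]

theorem circuitOf_prob {n m : ℕ} {W : Type} [Fintype W] [DecidableEq W]
    (L : List (WGate W)) (inp : Fin n ↪ W) (out : Fin m ↪ W) (x : Bits n) (y : Bits m) :
    (circuitOf L inp out).prob x y =
      ∑ v, if ∀ i, v (out i) = y i then transProb L (initBits inp x) v else 0 := by
  rw [QCircuit.prob, circuitOf_channel_diag, sum_single_mul, outcomeMatrix_diag,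
    Complex.ofReal_re]

theorem QCircuit.prob_nonneg {n m : ℕ} (C : QCircuit n m) (x : Bits n) (y : Bits m) :
    0 ≤ C.prob x y := by
  rw [C.prob_eq]
  refine Finset.sum_nonneg fun v _ => ?_
  split_ifs
  · exact Complex.normSq_nonneg _
  · rfl

theorem QCircuit.sum_prob {n m : ℕ} (C : QCircuit n m) (x : Bits n) : ∑ y, C.prob x y = 1 := by
  simp only [C.prob_eq]
  rw [Finset.sum_comm, ← sum_transProb C.wgates (initBits C.inp x)]
  refine Finset.sum_congr rfl fun v _ => ?_
  rw [Finset.sum_eq_single fun i => v (C.out i)]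
  · simp
  · intro y _ hy
    rw [if_neg fun h => hy (funext fun i => (h i).symm)]
  · simp

theorem QCircuit.length_wgates_le {n m : ℕ} (C : QCircuit n m) : C.wgates.length ≤ C.size := by
  simp [wgates, size]; omega

theorem QCircuit.width_le {n m : ℕ} (C : QCircuit n m) : C.width ≤ C.size := by
  simp [size]

theorem QCircuit.outputs_le {n m : ℕ} (C : QCircuit n m) : m ≤ C.size :=
  (by simpa using Fintype.card_le_of_embedding C.out : m ≤ C.width).trans C.width_le

/-! ### Reversible classical computation -/

/-- Adding the bit `F p v` to the wire `e p` for all `p`. -/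
noncomputable def xorFamily {P W : Type} (e : P ↪ W) (F : P → (W → Bool) → Bool) (v : W → Bool) :
    W → Bool :=
  Function.extend e (fun p => Bool.xor (v (e p)) (F p v)) v

theorem xorFamily_apply {P W : Type} (e : P ↪ W) (F : P → (W → Bool) → Bool) (v : W → Bool) (p : P) :
    xorFamily e F v (e p) = Bool.xor (v (e p)) (F p v) := e.injective.extend_apply _ _ _

theorem xorFamily_of_notMem {P W : Type} (e : P ↪ W) (F : P → (W → Bool) → Bool) (v : W → Bool)
    (w : W) (h : ∀ p, e p ≠ w) : xorFamily e F v w = v w :=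
  Function.extend_apply' _ _ _ fun ⟨p, hp⟩ => h p hp

section Classical

variable {W : Type} [DecidableEq W]

/-- The map `f` of basis states is computed by at most `B` gates. -/
def Implementable (B : ℕ) (f : (W → Bool) → (W → Bool)) : Prop :=
  ∃ L : List (WGate W), L.length ≤ B ∧ ∀ (ψ : Amp W) (v : W → Bool), act L ψ (f v) = ψ v

theorem Implementable.id : Implementable 0 (fun v : W → Bool => v) := ⟨[], le_rfl, fun _ _ => rfl⟩

theorem Implementable.comp {B B' : ℕ} {f g : (W → Bool) → (W → Bool)}
    (hf : Implementable B f) (hg : Implementable B' g) : Implementable (B + B') (g ∘ f) := by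
  obtain ⟨L, hL, h⟩ := hf
  obtain ⟨L', hL', h'⟩ := hg
  refine ⟨L ++ L', by simpa using Nat.add_le_add hL hL', fun ψ v => ?_⟩
  rw [act_append, Function.comp_apply, h', h]

theorem Implementable.mono {B B' : ℕ} {f : (W → Bool) → (W → Bool)}
    (hf : Implementable B f) (h : B ≤ B') : Implementable B' f :=
  let ⟨L, hL, hL'⟩ := hf
  ⟨L, hL.trans h, hL'⟩

/-- If `f` identified two strings `u` and `v`, the state obtained from `ket u` would have both
amplitudes 1 and 0 at their common image. -/
theorem bijective_of_act_eq [Finite W] {L : List (WGate W)} {f : (W → Bool) → (W → Bool)}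
    (h : ∀ (ψ : Amp W) (v : W → Bool), act L ψ (f v) = ψ v) : Function.Bijective f := by
  refine Finite.injective_iff_bijective.1 fun u v huv => ?_
  have h1 := h (ket u) u
  rw [huv, h] at h1
  by_contra hne
  simp [ket, Ne.symm hne] at h1

/-- Adding the bit `F v` to the wire `t`. -/
def xorOp (t : W) (F : (W → Bool) → Bool) (v : W → Bool) : W → Bool :=
  Function.update v t (Bool.xor (v t) (F v))

theorem implementable_cnot {c t : W} (h : c ≠ t) : Implementable 1 (xorOp t fun v => v c) := by
  refine ⟨[.CNOT c t h], le_rfl, fun ψ v => ?_⟩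
  simp [WGate.act, xorOp, Function.update_of_ne h]

/-- The second function is evaluated after `t` has changed, so it must not read `t`. -/
theorem Implementable.xor {B B' : ℕ} {t : W} {F F' : (W → Bool) → Bool}
    (hF : Implementable B (xorOp t F)) (hF' : Implementable B' (xorOp t F'))
    (h : ∀ v b, F' (Function.update v t b) = F' v) :
    Implementable (B + B') (xorOp t fun v => Bool.xor (F v) (F' v)) := by
  convert hF.comp hF' using 1
  funext v
  simp [xorOp, h]

/-! ### The Toffoli gate from CNOT, H and T -/

theorem omega8_pow_four : omega8 ^ 4 = -1 := by
  rw [omega8, ← Complex.exp_nat_mul, ← Complex.exp_pi_mul_I]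
  congr 1
  push_cast
  ring

theorem act_replicate_T (k : ℕ) (i : W) (ψ : Amp W) :
    act (List.replicate k (.T i)) ψ = fun x => (if x i then omega8 ^ k else 1) * ψ x := by
  induction k generalizing ψ with
  | zero => simp
  | succ k ih =>
    rw [List.replicate_succ, act_cons, ih]
    funext x
    simp only [WGate.act]
    split_ifs
    · ring
    · ring

/-- A phase depending on the parity of two bits. -/
def parityPhase (k : ℕ) (a b : W) (h : a ≠ b) : List (WGate W) :=
  .CNOT a b h :: (List.replicate k (.T b) ++ [.CNOT a b h])

theorem act_parityPhase (k : ℕ) (a b : W) (h : a ≠ b) (ψ : Amp W) :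
    act (parityPhase k a b h) ψ =
      fun x => (if Bool.xor (x b) (x a) then omega8 ^ k else 1) * ψ x := by
  funext x
  simp [parityPhase, act_append, act_replicate_T, WGate.act, Function.update_of_ne h]

/-- The doubly controlled sign gate. -/
def cczGates (a b c : W) (hab : a ≠ b) (hac : a ≠ c) (hbc : b ≠ c) : List (WGate W) :=
  [.T a, .T b, .T c] ++ (parityPhase 7 a b hab ++ (parityPhase 7 a c hac ++
    (parityPhase 7 b c hbc ++ (.CNOT a c hac :: (parityPhase 1 b c hbc ++ [.CNOT a c hac])))))

/-- This is the identity `4abc = a + b + c - (a⊕b) - (a⊕c) - (b⊕c) + (a⊕b⊕c)` in the exponent of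
`omega8`, with 7 in place of -1. The total exponent is 0 for three zero bits, 16 if one or two bits
are set, and 4 if all three are. -/
theorem act_cczGates (a b c : W) (hab : a ≠ b) (hac : a ≠ c) (hbc : b ≠ c) (ψ : Amp W) :
    act (cczGates a b c hab hac hbc) ψ =
      fun x => (if x a && x b && x c then -1 else 1) * ψ x := by
  have h8 : omega8 ^ 8 = 1 := by
    rw [show 8 = 4 * 2 from rfl, pow_mul, omega8_pow_four]; norm_num
  have h16 : omega8 ^ 16 = 1 := by
    rw [show 16 = 8 * 2 from rfl, pow_mul, h8]; norm_num
  funext x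
  simp only [cczGates, act_append, act_cons, act_nil, act_parityPhase, WGate.act,
    Function.update_self, Function.update_of_ne hac, Function.update_of_ne hbc,
    Function.update_idem]
  cases ha : x a <;> cases hb : x b <;> cases hc : x c <;>
    simp only [Bool.xor_false, Bool.xor_true, Bool.not_true, Bool.not_false, Bool.and_true,
      Bool.and_false, if_true, one_mul, pow_one, reduceIte, Bool.false_eq_true]
  all_goals
    have hx : Function.update x c (x c) = x := Function.update_eq_self c x
    rw [hc] at hx
    simp only [hx]
  all_goals first
    | linear_combination ψ x * h16
    | linear_combination ψ x * omega8_pow_four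

/-- Conjugation by H on the target turns a controlled sign into a controlled negation. The count is
35 gates for the sign and two for H. -/
theorem implementable_toffoli {a b t : W} (hab : a ≠ b) (hat : a ≠ t) (hbt : b ≠ t) :
    Implementable 37 (xorOp t fun v => v a && v b) := by
  refine ⟨.H t :: (cczGates a b t hab hat hbt ++ [.H t]), by simp [cczGates, parityPhase], ?_⟩
  intro ψ v
  have h2 : (Real.sqrt 2 : ℂ) ≠ 0 := by
    rw [Ne, Complex.ofReal_eq_zero]; positivity
  have h3 : (Real.sqrt 2 : ℂ) ^ 2 = 2 := by
    rw [← Complex.ofReal_pow, Real.sq_sqrt (by norm_num)]; norm_num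
  have hv : Function.update v t (v t) = v := Function.update_eq_self t v
  simp only [act_append, act_cons, act_nil, act_cczGates, WGate.act, xorOp,
    Function.update_self, Function.update_of_ne hat, Function.update_of_ne hbt,
    Function.update_idem]
  cases ha : v a <;> cases hb : v b <;> cases ht : v t <;>
    simp only [Bool.xor_false, Bool.xor_true, Bool.not_true, Bool.not_false, Bool.and_true,
      Bool.and_false, if_true, one_mul, reduceIte, Bool.false_eq_true] <;>
    rw [ht] at hv <;> simp only [hv] <;> field_simp <;> rw [h3] <;> ring

/-- Adding the bit `F w v` to the wire `w` for all `w` in a set `s` of wires. -/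
def xorLayer (s : Finset W) (F : W → (W → Bool) → Bool) (v : W → Bool) : W → Bool :=
  fun w => if w ∈ s then Bool.xor (v w) (F w v) else v w

/-- Since no `F w` reads a target wire, performing the additions one after another is the same as
performing them simultaneously. -/
theorem implementable_xorLayer {B : ℕ} (s : Finset W) (F : W → (W → Bool) → Bool)
    (hB : ∀ w ∈ s, Implementable B (xorOp w (F w)))
    (hF : ∀ w ∈ s, ∀ w' ∈ s, ∀ v b, F w (Function.update v w' b) = F w v) :
    Implementable (s.card * B) (xorLayer s F) := by
  induction s using Finset.induction_on with
  | empty =>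
    convert Implementable.id (W := W) using 1
    · simp
    · funext v w; simp [xorLayer]
  | insert a s ha ih =>
    have h := (ih (fun w hw => hB w (Finset.mem_insert_of_mem hw))
      (fun w hw w' hw' => hF w (Finset.mem_insert_of_mem hw) w' (Finset.mem_insert_of_mem hw')))
    have h' := (hB a (Finset.mem_insert_self a s)).comp h
    rw [Finset.card_insert_of_notMem ha, add_mul, one_mul, add_comm]
    convert h' using 1
    funext v w
    simp only [xorLayer, Function.comp_apply, xorOp]
    by_cases hw : w = a
    · subst hw
      simp [ha]
    · rw [Function.update_of_ne hw]
      by_cases hs : w ∈ s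
      · rw [if_pos (Finset.mem_insert_of_mem hs), if_pos hs,
          hF w (Finset.mem_insert_of_mem hs) a (Finset.mem_insert_self a s)]
      · rw [if_neg (by simp [hw, hs]), if_neg hs]

theorem implementable_xorFamily {P : Type} [Fintype P] {B : ℕ} (e : P ↪ W)
    (F : P → (W → Bool) → Bool) (hB : ∀ p, Implementable B (xorOp (e p) (F p)))
    (hF : ∀ p p' v b, F p (Function.update v (e p') b) = F p v) :
    Implementable (Fintype.card P * B) (xorFamily e F) := by
  let F' : W → (W → Bool) → Bool := Function.extend e F fun _ _ => false
  have hF' : ∀ p, F' (e p) = F p := fun p => e.injective.extend_apply _ _ _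
  have h := implementable_xorLayer (B := B) (Finset.univ.map e) F'
    (by
      intro w hw
      obtain ⟨p, _, rfl⟩ := Finset.mem_map.1 hw
      rw [hF']
      exact hB p)
    (by
      intro w hw w' hw' v b
      obtain ⟨p, _, rfl⟩ := Finset.mem_map.1 hw
      obtain ⟨p', _, rfl⟩ := Finset.mem_map.1 hw'
      rw [hF']
      exact hF p p' v b)
  rw [Finset.card_map, Finset.card_univ] at h
  convert h using 1
  funext v w
  by_cases hw : ∃ p, e p = w
  · obtain ⟨p, rfl⟩ := hw
    simp [xorFamily_apply, xorLayer, hF']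
  · have hw' : ∀ p, e p ≠ w := fun p hp => hw ⟨p, hp⟩
    simp [xorFamily_of_notMem e F v w hw', xorLayer, hw']

end Classical

/-! ### Parallel runs of a circuit -/

/-- The wires of the `i`-th copy. -/
def copyEmb (n : ℕ) (V R : Type) (i : Fin n) : V ↪ (Fin n × V) ⊕ R :=
  ⟨fun j => Sum.inl (i, j), fun j j' h => by simpa using h⟩

/-- The gates `L` on each of `n` copies of the wires `V`. -/
def parallelGates {V : Type} (n : ℕ) (R : Type) (L : List (WGate V)) : List (WGate ((Fin n × V) ⊕ R)) :=
  (List.finRange n).flatMap fun i => L.map (WGate.map (copyEmb n V R i))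

theorem length_parallelGates {n : ℕ} {V R : Type} (L : List (WGate V)) :
    (parallelGates n R L).length = n * L.length := by
  simp [parallelGates, List.length_flatMap]

/-- A state that is a product of states of the copies and of the remaining wires. -/
noncomputable def prodState {n : ℕ} {V R : Type} (φ : Fin n → Amp V) (r : Amp R) : Amp ((Fin n × V) ⊕ R) :=
  fun x => (∏ i, φ i fun j => x (Sum.inl (i, j))) * r fun q => x (Sum.inr q)

theorem ket_eq_prodState {n : ℕ} {V R : Type} (u : (Fin n × V) ⊕ R → Bool) :
    ket u = prodState (fun i => ket fun j => u (Sum.inl (i, j))) (ket fun q => u (Sum.inr q)) := by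
  funext x
  simp only [ket, prodState]
  by_cases h : x = u
  · simp [h]
  · rw [if_neg h]
    symm
    by_cases hr : (fun q => x (Sum.inr q)) = fun q => u (Sum.inr q)
    · have : ∃ i, ¬ (fun j => x (Sum.inl (i, j))) = fun j => u (Sum.inl (i, j)) := by
        by_contra hc
        push Not at hc
        apply h
        funext w
        rcases w with ⟨i, j⟩ | q
        · exact congrFun (hc i) j
        · exact congrFun hr q
      obtain ⟨i, hi⟩ := this
      rw [Finset.prod_eq_zero (Finset.mem_univ i) (if_neg hi), zero_mul]
    · rw [if_neg hr, mul_zero]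

section Parallel

variable {n : ℕ} {V R : Type} [DecidableEq V] [DecidableEq R]

/-- On a slice where all wires outside copy `i` are fixed, the other factors form a scalar, which
passes through the linear action. -/
theorem act_copy_prodState (L : List (WGate V)) (i : Fin n) (φ : Fin n → Amp V) (r : Amp R) :
    act (L.map (WGate.map (copyEmb n V R i))) (prodState φ r) =
      prodState (Function.update φ i (act L (φ i))) r := by
  funext x
  rw [act_map]
  have h : (fun u => prodState φ r (Function.extend (copyEmb n V R i) u x)) = fun u =>
      ((∏ j ∈ Finset.univ.erase i, φ j fun t => x (Sum.inl (j, t))) *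
        r fun q => x (Sum.inr q)) * φ i u := by
    funext u
    have h1 : (fun t => Function.extend (copyEmb n V R i) u x (Sum.inl (i, t))) = u :=
      extend_comp_embedding (copyEmb n V R i) x u
    have h2 : ∀ j ≠ i, (fun t => Function.extend (copyEmb n V R i) u x (Sum.inl (j, t))) =
        fun t => x (Sum.inl (j, t)) := by
      intro j hj
      funext t
      rw [Function.extend_apply']
      rintro ⟨a, ha⟩
      have ha' : (i, a) = (j, t) := Sum.inl_injective ha
      exact hj (Prod.ext_iff.1 ha').1.symm
    have h3 : (fun q => Function.extend (copyEmb n V R i) u x (Sum.inr q)) =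
        fun q => x (Sum.inr q) := by
      funext t
      rw [Function.extend_apply']
      rintro ⟨a, ha⟩
      exact Sum.inl_ne_inr ha
    simp only [prodState]
    rw [← Finset.mul_prod_erase Finset.univ _ (Finset.mem_univ i), h1, h3,
      Finset.prod_congr rfl fun j hj => by rw [h2 j (Finset.ne_of_mem_erase hj)]]
    ring
  rw [h, act_const_mul, prodState, ← Finset.mul_prod_erase Finset.univ _ (Finset.mem_univ i),
    Function.update_self]
  have h' : ∀ j ∈ Finset.univ.erase i,
      (Function.update φ i (act L (φ i)) j fun t => x (Sum.inl (j, t))) =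
        φ j fun t => x (Sum.inl (j, t)) := fun j hj => by
    rw [Function.update_of_ne (Finset.ne_of_mem_erase hj)]
  rw [Finset.prod_congr rfl h']
  change _ * act L (φ i) (fun j => x (Sum.inl (i, j))) = _
  ring

theorem act_parallelGates (L : List (WGate V)) (φ : Fin n → Amp V) (r : Amp R) :
    act (parallelGates n R L) (prodState φ r) = prodState (fun i => act L (φ i)) r := by
  have h : ∀ (l : List (Fin n)), l.Nodup → ∀ φ : Fin n → Amp V,
      act (l.flatMap fun i => L.map (WGate.map (copyEmb n V R i))) (prodState φ r) =
        prodState (fun i => if i ∈ l then act L (φ i) else φ i) r := by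
    intro l
    induction l with
    | nil => intro _ φ; simp
    | cons i l ih =>
      intro hl φ
      rw [List.nodup_cons] at hl
      rw [List.flatMap_cons, act_append, act_copy_prodState, ih hl.2]
      congr 1
      funext j
      by_cases hj : j = i
      · subst hj
        simp [hl.1]
      · simp [hj]
  rw [parallelGates, h _ (List.nodup_finRange n)]
  simp

/-- Assignments to the wires, as pairs of assignments to the copies and to the remaining wires. -/
def joinEquiv (n : ℕ) (V R : Type) :
    (Fin n → V → Bool) × (R → Bool) ≃ ((Fin n × V) ⊕ R → Bool) where
  toFun p := Sum.elim (fun q => p.1 q.1 q.2) p.2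
  invFun x := (fun i j => x (Sum.inl (i, j)), fun q => x (Sum.inr q))
  left_inv p := rfl
  right_inv x := by funext w; rcases w with ⟨i, j⟩ | q <;> rfl

theorem transProb_parallelGates [Fintype R] (L : List (WGate V)) (u : (Fin n × V) ⊕ R → Bool)
    (g : Fin n → V → Bool) (r : R → Bool) :
    transProb (parallelGates n R L) u (joinEquiv n V R (g, r)) =
      (∏ i, transProb L (fun j => u (Sum.inl (i, j))) (g i)) *
        if r = fun q => u (Sum.inr q) then 1 else 0 := by
  rw [transProb, ket_eq_prodState u, act_parallelGates, prodState, map_mul, map_prod]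
  congr 1
  change Complex.normSq (ket (fun q => u (Sum.inr q)) r) = _
  by_cases h : r = fun q => u (Sum.inr q) <;> simp [ket, h]

end Parallel

/-- Independent runs of `C` on the inputs `k₁, …, k_n`, followed by the reversible classical
computation `f`. -/
theorem parallel_prob {a b n N M : ℕ} (C : QCircuit a b) {R : Type} [Fintype R] [DecidableEq R]
    {L : List (WGate ((Fin n × Fin C.width) ⊕ R))}
    {f : ((Fin n × Fin C.width) ⊕ R → Bool) → ((Fin n × Fin C.width) ⊕ R → Bool)}
    (hf : ∀ ψ v, act L ψ (f v) = ψ v)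
    (inp : Fin N ↪ (Fin n × Fin C.width) ⊕ R) (out : Fin M ↪ (Fin n × Fin C.width) ⊕ R)
    (x : Bits N) (k : Fin n → Bits a) (r : R → Bool)
    (hx : initBits inp x = Sum.elim (fun q => initBits C.inp (k q.1) q.2) r)
    (y : Bits M) (P : (Fin n → Bits b) → Prop) [DecidablePred P]
    (hP : ∀ g : Fin n → Bits C.width,
      (∀ i, f (joinEquiv n (Fin C.width) R (g, r)) (out i) = y i) ↔
        P fun i t => g i (C.out t)) :
    (circuitOf (parallelGates n R C.wgates ++ L) inp out).prob x y =
      ∑ z : Fin n → Bits b, if P z then ∏ i, C.prob (k i) (z i) else 0 := by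
  classical
  -- Summing over `f v` instead of over final strings undoes the classical part: the probability of
  -- `f v` at the end is that of `v` just after the parallel runs.
  rw [circuitOf_prob, ← Equiv.sum_comp (Equiv.ofBijective f (bijective_of_act_eq hf)),
    ← Equiv.sum_comp (joinEquiv n (Fin C.width) R), Fintype.sum_prod_type]
  simp only [Equiv.ofBijective_apply]
  have h1 : ∀ (g : Fin n → Bits C.width) (r' : R → Bool),
      transProb (parallelGates n R C.wgates ++ L) (initBits inp x)
        (f (joinEquiv n (Fin C.width) R (g, r'))) =
      (∏ i, transProb C.wgates (initBits C.inp (k i)) (g i)) * if r' = r then 1 else 0 := by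
    intro g r'
    have h := transProb_parallelGates C.wgates (initBits inp x) g r'
    unfold transProb at h ⊢
    rw [act_append, hf, h, hx]
    rfl
  simp only [h1]
  have h2 : ∀ g : Fin n → Bits C.width, (∑ r' : R → Bool,
      if ∀ i, f (joinEquiv n (Fin C.width) R (g, r')) (out i) = y i then
        (∏ i, transProb C.wgates (initBits C.inp (k i)) (g i)) * (if r' = r then 1 else 0)
      else 0) =
      if P fun i t => g i (C.out t) then
        ∏ i, transProb C.wgates (initBits C.inp (k i)) (g i) else 0 := by
    intro g
    rw [Finset.sum_eq_single r]
    · simp [hP]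
    · intro r' _ hr'; simp [hr']
    · simp
  rw [Finset.sum_congr rfl fun g _ => h2 g]
  -- The product of the marginals, expanded over the complete final strings of all copies, is a sum
  -- over the fibre of `z`.
  have h3 : ∀ z : Fin n → Bits b, ∏ i, C.prob (k i) (z i) =
      ∑ g : Fin n → Bits C.width, if (fun i t => g i (C.out t)) = z then
        ∏ i, transProb C.wgates (initBits C.inp (k i)) (g i) else 0 := by
    intro z
    simp only [C.prob_eq]
    rw [Fintype.prod_sum]
    refine Finset.sum_congr rfl fun g _ => ?_
    by_cases hz : (fun i t => g i (C.out t)) = z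
    · subst hz
      simp
    · rw [if_neg hz]
      have : ∃ i, ¬ ∀ t, g i (C.out t) = z i t := by
        by_contra hc
        push Not at hc
        exact hz (funext fun i => funext fun t => hc i t)
      obtain ⟨i, hi⟩ := this
      exact Finset.prod_eq_zero (Finset.mem_univ i) (if_neg hi)
  have h4 : ∀ z : Fin n → Bits b, (if P z then ∏ i, C.prob (k i) (z i) else 0) =
      ∑ g : Fin n → Bits C.width, if (fun i t => g i (C.out t)) = z then
        (if P z then ∏ i, transProb C.wgates (initBits C.inp (k i)) (g i) else 0) else 0 := by
    intro z
    rw [h3]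
    split_ifs <;> simp
  rw [Finset.sum_congr rfl fun z _ => h4 z, Finset.sum_comm]
  refine Finset.sum_congr rfl fun g _ => ?_
  simp

/-! ### Circuits for key generation, encryption and decryption -/

/-- The circuit that outputs a random bit. -/
def coinCircuit : QCircuit 0 1 where
  width := 1
  gates := [.H 0]
  inp := ⟨Fin.elim0, fun i => i.elim0⟩
  out := Function.Embedding.refl _

theorem coinCircuit_prob (x : Bits 0) (y : Bits 1) : coinCircuit.prob x y = 1 / 2 := by
  let inp : Fin 0 ↪ Fin 1 := ⟨Fin.elim0, fun i => i.elim0⟩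
  have h : coinCircuit.prob x y = ∑ v : Fin 1 → Bool, if ∀ i, v i = y i then
      transProb [WGate.H (0 : Fin 1)] (initBits inp x) v else 0 := coinCircuit.prob_eq x y
  rw [h, Finset.sum_eq_single y]
  · have h0 : initBits inp x = fun _ => false :=
      funext fun w => initBits_of_notMem _ _ _ fun i => i.elim0
    have hu : ∀ b, Function.update y (0 : Fin 1) b = fun _ => b := by
      intro b; funext j; rw [Subsingleton.elim j 0, Function.update_self]
    have ht : (fun _ : Fin 1 => true) ≠ fun _ => false := fun h => by simpa using congrFun h 0
    rw [if_pos (fun i => rfl), h0, transProb, act_cons, act_nil]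
    simp only [WGate.act]
    rw [hu, hu, map_div₀, normSq_sqrt_two]
    simp [ket, ht]
  · intro v _ hv
    rw [if_neg fun h => hv (funext h)]
  · simp

theorem exists_uniform_circuit (N : ℕ) :
    ∃ C : QCircuit 0 N, C.size ≤ 3 * N ∧ ∀ x k, C.prob x k = 1 / 2 ^ N := by
  let out : Fin N ↪ (Fin N × Fin coinCircuit.width) ⊕ Empty :=
    ⟨fun i => Sum.inl (i, (0 : Fin 1)), fun i j h => (Prod.ext_iff.1 (Sum.inl_injective h)).1⟩
  let inp : Fin 0 ↪ (Fin N × Fin coinCircuit.width) ⊕ Empty :=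
    ⟨Fin.elim0, fun i => i.elim0⟩
  refine ⟨circuitOf (parallelGates N Empty coinCircuit.wgates ++ []) inp out, ?_, fun x k => ?_⟩
  · rw [circuitOf_size, List.append_nil, length_parallelGates]
    have h : Fintype.card ((Fin N × Fin coinCircuit.width) ⊕ Empty) = N := by
      rw [Fintype.card_sum, Fintype.card_prod, Fintype.card_fin, Fintype.card_fin,
        Fintype.card_empty]
      exact Nat.mul_one N
    have h' : coinCircuit.wgates.length = 1 := rfl
    rw [h, h']
    omega
  · rw [parallel_prob coinCircuit (f := fun v => v) (fun _ _ => rfl) inp out x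
      (fun _ => Fin.elim0) Empty.elim ?_ k (fun z => z = fun i _ => k i) ?_]
    · simp [coinCircuit_prob]
    · funext w
      rcases w with q | q
      · rw [initBits_of_notMem _ _ _ fun i => i.elim0, Sum.elim_inl,
          initBits_of_notMem _ _ _ fun i => i.elim0]
      · exact q.elim
    · intro g
      refine ⟨fun h => ?_, fun h i => congrFun (congrFun h i) 0⟩
      funext i t
      rw [Subsingleton.elim t 0]
      exact h i

/-- The input wires for the string `k₁ || … || k_r || c`, where `k_i` goes to the `i`-th copy and
`c` to the remaining wires. -/
def keyInp {r n N w : ℕ} {R : Type} (inp : Fin n ↪ Fin w) (rest : Fin N ↪ R) :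
    Fin (r * n + N) ↪ (Fin r × Fin w) ⊕ R :=
  (finSumFinEquiv.symm.trans
    (Equiv.sumCongr finProdFinEquiv.symm (Equiv.refl (Fin N)))).toEmbedding.trans
    (Function.Embedding.sumMap ((Function.Embedding.refl (Fin r)).prodMap inp) rest)

theorem initBits_keyInp {r n N w : ℕ} {R : Type} (inp : Fin n ↪ Fin w) (rest : Fin N ↪ R)
    (k : Bits (r * n)) (c : Bits N) :
    initBits (keyInp inp rest) (Fin.append k c) =
      Sum.elim (fun q => initBits inp (block k q.1) q.2) (initBits rest c) := by
  symm
  have hl : ∀ i j, keyInp inp rest (Fin.castAdd N (finProdFinEquiv (i, j))) =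
      Sum.inl ((i : Fin r), inp j) := by
    intro i j
    simp [keyInp]
  have hr : ∀ t, keyInp (r := r) inp rest (Fin.natAdd (r * n) t) = Sum.inr (rest t) := by
    intro t
    simp [keyInp]
  refine (eq_initBits_iff _ _ _).2 ⟨?_, ?_⟩
  · funext t
    refine Fin.addCases (fun i => ?_) (fun i => ?_) t
    · obtain ⟨⟨a, b⟩, rfl⟩ := finProdFinEquiv.surjective i
      rw [hl, Fin.append_left, Sum.elim_inl, initBits_apply]; rfl
    · rw [hr, Fin.append_right, Sum.elim_inr, initBits_apply]
  · rintro (⟨i, j⟩ | q) h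
    · refine initBits_of_notMem _ _ _ fun t ht => h (Fin.castAdd N (finProdFinEquiv (i, t))) ?_
      rw [hl, ht]
    · refine initBits_of_notMem _ _ _ fun t ht => h (Fin.natAdd (r * n) t) ?_
      rw [hr, ht]

/-- The message stays on its own `l` wires and is added by CNOT to the output wires of each copy,
which then carry the ciphertext. -/
theorem exists_enc_circuit {r n l : ℕ} (C : QCircuit n l) :
    ∃ E : QCircuit (r * n + l) (r * l), E.size ≤ 4 * (r * C.size) + 2 * C.size ∧
      ∀ k m c, E.prob (Fin.append k m) c = ∑ y : Fin r → Bits l,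
        if (concat fun i => bxor m (y i)) = c then ∏ i, C.prob (block k i) (y i) else 0 := by
  let outE : Fin r × Fin l ↪ (Fin r × Fin C.width) ⊕ Fin l :=
    ((Function.Embedding.refl (Fin r)).prodMap C.out).trans Function.Embedding.inl
  let F : Fin r × Fin l → ((Fin r × Fin C.width) ⊕ Fin l → Bool) → Bool :=
    fun p v => v (Sum.inr p.2)
  obtain ⟨L, hL, hf⟩ := implementable_xorFamily (B := 1) outE F
    (fun p => implementable_cnot (Sum.inr_ne_inl))
    (fun p p' v b => Function.update_of_ne Sum.inr_ne_inl _ _)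
  refine ⟨circuitOf (parallelGates r (Fin l) C.wgates ++ L)
    (keyInp C.inp (Function.Embedding.refl (Fin l)))
    (finProdFinEquiv.symm.toEmbedding.trans outE), ?_, fun k m c => ?_⟩
  · rw [circuitOf_size, List.length_append, length_parallelGates]
    simp only [Fintype.card_prod, Fintype.card_fin, mul_one, Fintype.card_sum] at hL ⊢
    have h1 := Nat.mul_le_mul_left r C.length_wgates_le
    have h2 := Nat.mul_le_mul_left r C.width_le
    have h3 := Nat.mul_le_mul_left r C.outputs_le
    have h4 := C.outputs_le
    omega
  · have hm : initBits (Function.Embedding.refl (Fin l)) m = m :=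
      funext fun t => initBits_apply (Function.Embedding.refl (Fin l)) m t
    refine parallel_prob C hf _ _ _ (block k) m ?_ c _ fun g => ?_
    · rw [initBits_keyInp, hm]
    · rw [funext_iff]
      refine forall_congr' fun t => ?_
      rw [Function.Embedding.trans_apply, xorFamily_apply]
      have : (joinEquiv r (Fin C.width) (Fin l)) (g, m) (outE (finProdFinEquiv.symm t)) =
        g (finProdFinEquiv.symm t).1 (C.out (finProdFinEquiv.symm t).2) := rfl
      rw [Equiv.coe_toEmbedding, this]
      change Bool.xor _ (m (finProdFinEquiv.symm t).2) = _ ↔ _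
      rw [Bool.xor_comm]
      rfl

/-! ### Majority by unary counting -/

/-- The number of strings among the first `s` that have a `1` at a given position. -/
def prefixCount {r : ℕ} (b : Fin r → Bool) (s : ℕ) : ℕ :=
  (Finset.univ.filter fun i : Fin r => (i : ℕ) < s ∧ b i = true).card

theorem prefixCount_succ {r : ℕ} (b : Fin r → Bool) (s : Fin r) :
    prefixCount b (s + 1) = prefixCount b s + if b s then 1 else 0 := by
  unfold prefixCount
  split_ifs with h
  · rw [← Finset.card_insert_of_notMem (a := s) (by simp)]
    congr 1
    ext i
    simp only [Finset.mem_filter, Finset.mem_univ, true_and, Finset.mem_insert]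
    constructor
    · rintro ⟨h1, h2⟩
      rcases Nat.lt_succ_iff_lt_or_eq.1 h1 with h3 | h3
      · exact Or.inr ⟨h3, h2⟩
      · exact Or.inl (Fin.ext h3)
    · rintro (rfl | ⟨h1, h2⟩)
      · exact ⟨Nat.lt_succ_self _, h⟩
      · exact ⟨Nat.lt_succ_of_lt h1, h2⟩
  · rw [add_zero]
    congr 1
    ext i
    simp only [Finset.mem_filter, Finset.mem_univ, true_and]
    refine ⟨fun ⟨h1, h2⟩ => ⟨?_, h2⟩, fun ⟨h1, h2⟩ => ⟨Nat.lt_succ_of_lt h1, h2⟩⟩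
    refine lt_of_le_of_ne (Nat.lt_succ_iff.1 h1) fun h3 => h ?_
    rwa [← Fin.ext h3]

/-- The wires for the computation of the majority: a ciphertext, and for all `s`, `j` and each
position a wire that indicates whether more than `j` of the first `s` strings have a `1` there. -/
abbrev CountWires (r l : ℕ) : Type :=
  (Fin r × Fin l) ⊕ (Fin (r + 1) × Fin (r + 1) × Fin l)

section Counting

variable {r l : ℕ} {U : Type} [DecidableEq U]

/-- The wires for the counts of the first `s + 1` strings. -/
def countEmb (U : Type) {r l : ℕ} (s : Fin r) : Fin (r + 1) × Fin l ↪ U ⊕ CountWires r l :=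
  ⟨fun p => Sum.inr (Sum.inr (s.succ, p.1, p.2)), fun p q h => by
    have h' := Sum.inr_injective (Sum.inr_injective h)
    exact (Prod.ext_iff.1 h').2⟩

/-- The update of the counts by the string number `s`. -/
def countStep (U : Type) {r l : ℕ} (s : Fin r) (p : Fin (r + 1) × Fin l)
    (v : U ⊕ CountWires r l → Bool) : Bool :=
  Fin.cases
    (Bool.xor (Bool.xor (v (Sum.inr (Sum.inr (s.castSucc, 0, p.2))))
      (v (Sum.inr (Sum.inl (s, p.2)))))
      (v (Sum.inr (Sum.inl (s, p.2))) && v (Sum.inr (Sum.inr (s.castSucc, 0, p.2)))))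
    (fun j => Bool.xor (Bool.xor (v (Sum.inr (Sum.inr (s.castSucc, j.succ, p.2))))
      (v (Sum.inr (Sum.inl (s, p.2))) && v (Sum.inr (Sum.inr (s.castSucc, j.castSucc, p.2)))))
      (v (Sum.inr (Sum.inl (s, p.2))) && v (Sum.inr (Sum.inr (s.castSucc, j.succ, p.2)))))
    p.1

/-- Each new bit costs at most one CNOT and two Toffoli gates, and 1 + 37 + 37 = 75. The wires read
are the ciphertext and row `s`, while those written form row `s + 1`; a fresh row for each string
makes uncomputation unnecessary. -/
theorem implementable_countStep (s : Fin r) :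
    Implementable ((r + 1) * l * 75) (xorFamily (countEmb U s) (countStep U (l := l) s)) := by
  have hne : ∀ (q : Fin r × Fin l) p, (Sum.inr (Sum.inl q) : U ⊕ CountWires r l) ≠
      countEmb U s p := by
    intro q p h
    exact Sum.inl_ne_inr (Sum.inr_injective h)
  have hne' : ∀ j t p, (Sum.inr (Sum.inr (s.castSucc, j, t)) : U ⊕ CountWires r l) ≠
      countEmb U s p := by
    intro j t p h
    have h' := Sum.inr_injective (Sum.inr_injective h)
    have h'' := congrArg Fin.val (Prod.ext_iff.1 h').1
    simp at h''
  have hne'' : ∀ (q : Fin r × Fin l) a, (Sum.inr (Sum.inl q) : U ⊕ CountWires r l) ≠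
      Sum.inr (Sum.inr a) := by
    intro q a h
    exact Sum.inl_ne_inr (Sum.inr_injective h)
  have h := implementable_xorFamily (B := 75) (countEmb U s) (countStep U (l := l) s) ?_ ?_
  · simpa using h
  · rintro ⟨j, t⟩
    refine Fin.cases ?_ (fun j => ?_) j
    · refine Implementable.mono (B := 1 + 1 + 37) ?_ (by norm_num)
      refine ((implementable_cnot (hne' 0 t _)).xor (implementable_cnot (hne (s, t) _)) ?_).xor
        (implementable_toffoli (hne'' _ _) (hne (s, t) _) (hne' 0 t _)) ?_
      · intro v b; exact Function.update_of_ne (hne _ _) _ _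
      · intro v b
        rw [Function.update_of_ne (hne _ _), Function.update_of_ne (hne' _ _ _)]
    · refine ((implementable_cnot (hne' j.succ t _)).xor
        (implementable_toffoli (hne'' _ _) (hne (s, t) _) (hne' j.castSucc t _)) ?_).xor
        (implementable_toffoli (hne'' _ _) (hne (s, t) _) (hne' j.succ t _)) ?_
      · intro v b
        rw [Function.update_of_ne (hne _ _), Function.update_of_ne (hne' _ _ _)]
      · intro v b
        rw [Function.update_of_ne (hne _ _), Function.update_of_ne (hne' _ _ _)]
  · rintro ⟨j, t⟩ p' v b
    refine Fin.cases ?_ (fun j => ?_) j <;>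
    simp only [countStep, Fin.cases_zero, Fin.cases_succ, Function.update_of_ne (hne _ _),
      Function.update_of_ne (hne' _ _ _)]

/-- The counts are computed by polynomially many gates. -/
theorem exists_count (k : ℕ) (hk : k ≤ r) :
    ∃ f : (U ⊕ CountWires r l → Bool) → (U ⊕ CountWires r l → Bool),
      Implementable (k * ((r + 1) * l * 75)) f ∧
      ∀ v, (∀ a, v (Sum.inr (Sum.inr a)) = false) →
        (∀ q, f v (Sum.inr (Sum.inl q)) = v (Sum.inr (Sum.inl q))) ∧
        ∀ s j t, f v (Sum.inr (Sum.inr (s, j, t))) =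
          decide ((s : ℕ) ≤ k ∧ (j : ℕ) < prefixCount (fun i => v (Sum.inr (Sum.inl (i, t)))) s) := by
  induction k with
  | zero =>
    -- No gates are needed: row 0 is correct because it is initialized to zero and the empty count
    -- exceeds no `j`.
    refine ⟨fun v => v, by simpa using Implementable.id, fun v hv => ⟨fun q => rfl, fun s j t => ?_⟩⟩
    change v _ = _
    rw [hv, eq_comm, decide_eq_false_iff_not]
    rintro ⟨h1, h2⟩
    rw [Nat.le_zero.1 h1] at h2
    simp [prefixCount] at h2
  | succ k ih =>
    obtain ⟨f, hf, h⟩ := ih (by omega)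
    let s₀ : Fin r := ⟨k, hk⟩
    refine ⟨_ ∘ f, by
      rw [add_mul, one_mul]
      exact hf.comp (implementable_countStep s₀), fun v hv => ?_⟩
    obtain ⟨h1, h2⟩ := h v hv
    have hc : ∀ q, xorFamily (countEmb U s₀) (countStep U (l := l) s₀) (f v) (Sum.inr (Sum.inl q)) =
        v (Sum.inr (Sum.inl q)) := by
      intro q
      rw [xorFamily_of_notMem, h1]
      intro p hp
      exact Sum.inr_ne_inl (Sum.inr_injective hp)
    refine ⟨hc, fun s j t => ?_⟩
    rw [Function.comp_apply]
    by_cases hs : s = s₀.succ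
    · subst hs
      rw [show (Sum.inr (Sum.inr (s₀.succ, j, t)) : U ⊕ CountWires r l) =
        countEmb U s₀ (j, t) from rfl, xorFamily_apply]
      rw [show countEmb U s₀ (j, t) =
        (Sum.inr (Sum.inr (s₀.succ, j, t)) : U ⊕ CountWires r l) from rfl, h2]
      have hcount := prefixCount_succ (fun i => v (Sum.inr (Sum.inl (i, t)))) s₀
      have hs₀ : ((s₀ : Fin r) : ℕ) = k := rfl
      rw [hs₀] at hcount
      simp only [Fin.val_succ, hs₀, hcount]
      -- For old count `c` and new bit `b`, `[c+b > 0] = [c > 0] ⊕ b ⊕ b[c > 0]` and `[c+b > j+1] =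
      -- [c > j+1] ⊕ b[c > j] ⊕ b[c > j+1]`; the latter uses that `c > j+1` implies `c > j`.
      refine Fin.cases ?_ (fun j => ?_) j
      · simp only [countStep, Fin.cases_zero, h1, h2, Fin.val_castSucc, hs₀]
        generalize prefixCount (fun i => v (Sum.inr (Sum.inl (i, t)))) k = c
        cases v (Sum.inr (Sum.inl (s₀, t))) <;> by_cases hj : 0 < c <;> simp [hj]
      · simp only [countStep, Fin.cases_succ, h1, h2, Fin.val_castSucc, Fin.val_succ, hs₀]
        generalize prefixCount (fun i => v (Sum.inr (Sum.inl (i, t)))) k = c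
        by_cases hj : (j : ℕ) + 1 < c
        · have hj' : (j : ℕ) < c := by omega
          cases v (Sum.inr (Sum.inl (s₀, t))) <;> simp [hj, hj']
        · by_cases hj' : (j : ℕ) < c <;>
          cases v (Sum.inr (Sum.inl (s₀, t))) <;> simp [hj, hj']
    · have hs' : (s : ℕ) ≠ k + 1 := fun h => hs (Fin.ext h)
      rw [xorFamily_of_notMem, h2]
      · simp only [decide_eq_decide]
        have : (s : ℕ) ≤ k ↔ (s : ℕ) ≤ k + 1 := by omega
        rw [this]
      · intro p hp
        exact hs (Prod.ext_iff.1 (Sum.inr_injective (Sum.inr_injective hp))).1.symm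

end Counting

/-- The outputs of the fresh runs are added to the ciphertext wires, whose blocks become the
candidate messages. The counts of ones are then computed position by position, and all wires but the
final threshold bits are traced out. -/
theorem exists_dec_circuit {r n l : ℕ} (C : QCircuit n l) :
    ∃ D : QCircuit (r * n + r * l) l,
      D.size ≤ r * C.size + r * C.size + r * ((r + 1) * C.size * 75) +
        2 * (r * C.size + (r * C.size + (r + 1) * ((r + 1) * C.size))) ∧
      ∀ k c m, D.prob (Fin.append k c) m = ∑ y : Fin r → Bits l,
        if (maj fun i => bxor (block c i) (y i)) = m then
          ∏ i, C.prob (block k i) (y i) else 0 := by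
  let e : Fin r × Fin l ↪ (Fin r × Fin C.width) ⊕ CountWires r l :=
    Function.Embedding.inl.trans Function.Embedding.inr
  let F : Fin r × Fin l → ((Fin r × Fin C.width) ⊕ CountWires r l → Bool) → Bool :=
    fun p v => v (Sum.inl (p.1, C.out p.2))
  have hlayer := implementable_xorFamily (B := 1) e F
    (fun p => implementable_cnot (Sum.inl_ne_inr))
    (fun p p' v b => Function.update_of_ne Sum.inl_ne_inr _ _)
  obtain ⟨f, hf, hcount⟩ := exists_count (U := Fin r × Fin C.width) (r := r) (l := l) r le_rfl
  obtain ⟨L, hL, hact⟩ := hlayer.comp hf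
  let out : Fin l ↪ (Fin r × Fin C.width) ⊕ CountWires r l :=
    -- A count exceeds the rounded-down `r / 2` exactly when its double exceeds `r`, for either
    -- parity of `r`.
    ⟨fun t => Sum.inr (Sum.inr (Fin.last r, ⟨r / 2, by omega⟩, t)), fun t t' h => by
      have h' := Sum.inr_injective (Sum.inr_injective h)
      exact (Prod.ext_iff.1 (Prod.ext_iff.1 h').2).2⟩
  let rest : Fin (r * l) ↪ CountWires r l :=
    finProdFinEquiv.symm.toEmbedding.trans Function.Embedding.inl
  refine ⟨circuitOf (parallelGates r (CountWires r l) C.wgates ++ L) (keyInp C.inp rest) out,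
    ?_, fun k c m => ?_⟩
  · rw [circuitOf_size, List.length_append, length_parallelGates]
    simp only [Fintype.card_prod, Fintype.card_fin, mul_one, Fintype.card_sum] at hL ⊢
    have h1 := Nat.mul_le_mul_left r C.length_wgates_le
    have h2 := Nat.mul_le_mul_left r C.width_le
    have h3 := Nat.mul_le_mul_left r C.outputs_le
    have h4 := Nat.mul_le_mul_left r
      (Nat.mul_le_mul_right 75 (Nat.mul_le_mul_left (r + 1) C.outputs_le))
    have h5 := Nat.mul_le_mul_left (r + 1) (Nat.mul_le_mul_left (r + 1) C.outputs_le)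
    omega
  · have hrest : initBits rest c = Sum.elim (fun q => c (finProdFinEquiv q)) fun _ => false := by
      symm
      refine (eq_initBits_iff _ _ _).2 ⟨?_, ?_⟩
      · funext t
        exact congrArg c (finProdFinEquiv.apply_symm_apply t)
      · rintro (q | q) h
        · exact absurd (by simp [rest]) (h (finProdFinEquiv q))
        · rfl
    refine parallel_prob C hact _ _ _ (block k) _ (initBits_keyInp _ _ _ _) m _ fun g => ?_
    rw [funext_iff]
    refine forall_congr' fun t => ?_
    rw [hrest, Function.comp_apply]
    set v := joinEquiv r (Fin C.width) (CountWires r l)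
      (g, Sum.elim (fun q => c (finProdFinEquiv q)) fun _ => false) with hv
    have h0 : ∀ a, xorFamily e F v (Sum.inr (Sum.inr a)) = false := by
      intro a
      rw [xorFamily_of_notMem]
      · rfl
      · intro p hp
        exact Sum.inl_ne_inr (Sum.inr_injective hp)
    have h1 : ∀ i, xorFamily e F v (Sum.inr (Sum.inl (i, t))) =
        bxor (block c i) (fun t => g i (C.out t)) t := fun i => xorFamily_apply e F v (i, t)
    have h2 : f (xorFamily e F v) (out t) =
        maj (fun i => bxor (block c i) fun t => g i (C.out t)) t := by
      refine ((hcount _ h0).2 _ _ _).trans ?_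
      unfold maj
      rw [decide_eq_decide]
      simp only [h1, prefixCount, Fin.val_last, le_refl, true_and, Fin.is_lt]
      omega
    rw [h2]

/-! ### Products of distributions -/

/-- Strings of length `a * b` as families of `a` blocks. -/
def blockEquiv (a b : ℕ) : Bits (a * b) ≃ (Fin a → Bits b) where
  toFun := block
  invFun := concat
  left_inv s := funext fun t => congrArg s (finProdFinEquiv.apply_symm_apply t)
  right_inv s := by funext i j; simp [concat, block]

theorem block_concat {a b : ℕ} (s : Fin a → Bits b) (i : Fin a) : block (concat s) i = s i :=
  congrFun ((blockEquiv a b).right_inv s) i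

/-- The blocks of a uniform string are independent and uniform. -/
theorem average_prod_block {a b : ℕ} (h : Fin a → Bits b → ℝ) :
    ∑ k : Bits (a * b), (1 / 2 ^ (a * b) : ℝ) * ∏ i, h i (block k i) =
      ∏ i, ∑ κ : Bits b, (1 / 2 ^ b : ℝ) * h i κ := by
  rw [Fintype.prod_sum, ← Equiv.sum_comp (blockEquiv a b)]
  refine Finset.sum_congr rfl fun k _ => ?_
  rw [Finset.prod_mul_distrib, Finset.prod_const, Finset.card_univ, Fintype.card_fin, one_div_pow,
    ← pow_mul, mul_comm b a]
  rfl

theorem bxor_cancel {n : ℕ} (m y : Bits n) : bxor (bxor m y) y = m := by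
  funext i; simp [bxor]

theorem bxor_bxor_self {n : ℕ} (m y : Bits n) : bxor m (bxor m y) = y := by
  funext i; simp [bxor]

/-! ### Correctness -/

/-- The weight of a pair of runs: the product of the weights over all blocks is at least one if at
most half of the blocks agree. -/
noncomputable def pairWeight {n : ℕ} (y y' : Bits n) : ℝ := if y = y' then 1 / 8 else 8

theorem pairWeight_nonneg {n : ℕ} (y y' : Bits n) : 0 ≤ pairWeight y y' := by
  unfold pairWeight; split_ifs <;> norm_num

theorem one_le_prod_pairWeight {r n : ℕ} (y y' : Fin r → Bits n)
    (h : 2 * (Finset.univ.filter fun i => y i = y' i).card ≤ r) :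
    1 ≤ ∏ i, pairWeight (y i) (y' i) := by
  unfold pairWeight
  rw [Finset.prod_ite, Finset.prod_const, Finset.prod_const]
  have hc := Finset.card_filter_add_card_filter_not (s := (Finset.univ : Finset (Fin r)))
    (fun i => y i = y' i)
  rw [Finset.card_univ, Fintype.card_fin] at hc
  have h' : (Finset.univ.filter fun i => y i = y' i).card ≤
      (Finset.univ.filter fun i => ¬ y i = y' i).card := by omega
  calc (1 : ℝ) = (1 / 8) ^ (Finset.univ.filter fun i => y i = y' i).card *
        8 ^ (Finset.univ.filter fun i => y i = y' i).card := by
        rw [← mul_pow]; norm_num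
    _ ≤ _ := by
        gcongr
        norm_num

/-- If decryption fails, `m` is not a strict majority among the candidates, so at most half of the
pairs agree and the product of the weights is at least 1. This is the pointwise form of an
exponential Markov bound. -/
theorem indicator_maj_ge {r n : ℕ} (m : Bits n) (y y' : Fin r → Bits n) :
    1 - ∏ i, pairWeight (y i) (y' i) ≤
      if (maj fun i => bxor (bxor m (y i)) (y' i)) = m then (1 : ℝ) else 0 := by
  have hpos : 0 ≤ ∏ i, pairWeight (y i) (y' i) := Finset.prod_nonneg fun i _ => pairWeight_nonneg _ _
  split_ifs with h
  · linarith
  · have := one_le_prod_pairWeight y y' (by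
      by_contra hc
      refine h (maj_eq_of_majority _ m ((not_le.1 hc).trans_le ?_))
      refine Nat.mul_le_mul_left 2 (Finset.card_le_card fun i hi => ?_)
      simp only [Finset.mem_filter, Finset.mem_univ, true_and] at hi ⊢
      rw [hi, bxor_cancel])
    linarith

/-- The probability that two runs on a random seed agree. -/
noncomputable def collisionProb {n l : ℕ} (C : QCircuit n l) : ℝ :=
  ∑ k : Bits n, (1 / 2 ^ n : ℝ) * ∑ y, C.prob k y * C.prob k y

/-- The weight is 8 minus 63/8 times the indicator of a collision. -/
theorem average_pairWeight {n l : ℕ} (C : QCircuit n l) :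
    ∑ k : Bits n, (1 / 2 ^ n : ℝ) * ∑ y, ∑ y', C.prob k y * C.prob k y' * pairWeight y y' =
      8 - 63 / 8 * collisionProb C := by
  have h : ∀ k, ∑ y, ∑ y', C.prob k y * C.prob k y' * pairWeight y y' =
      8 - 63 / 8 * ∑ y, C.prob k y * C.prob k y := by
    intro k
    have h1 : ∀ y y', C.prob k y * C.prob k y' * pairWeight y y' =
        8 * (C.prob k y * C.prob k y') -
          63 / 8 * (if y = y' then C.prob k y * C.prob k y' else 0) := by
      intro y y'
      unfold pairWeight
      split_ifs <;> ring
    simp only [h1, Finset.sum_sub_distrib, ← Finset.mul_sum, Finset.sum_ite_eq, Finset.mem_univ,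
      if_true, C.sum_prob, mul_one]
  simp only [h, mul_sub, Finset.sum_sub_distrib]
  congr 1
  · rw [← Finset.sum_mul]
    simp
  · rw [collisionProb, Finset.mul_sum]
    exact Finset.sum_congr rfl fun k _ => by ring

/-- One factor `δ` is for a good seed, and two more are for both runs giving its likely output. -/
theorem collisionProb_ge {n l : ℕ} (C : QCircuit n l) (K : Finset (Bits n)) (δ : ℝ) (hδ : 0 ≤ δ)
    (hK : δ ≤ (K.card : ℝ) / 2 ^ n) (h : ∀ k ∈ K, ∃ y, δ ≤ C.prob k y) :
    δ ^ 3 ≤ collisionProb C := by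
  have h1 : ∀ k, 0 ≤ ∑ y, C.prob k y * C.prob k y :=
    fun k => Finset.sum_nonneg fun y _ => mul_self_nonneg _
  have h2 : ∀ k ∈ K, δ ^ 2 ≤ ∑ y, C.prob k y * C.prob k y := by
    intro k hk
    obtain ⟨y, hy⟩ := h k hk
    calc δ ^ 2 ≤ C.prob k y * C.prob k y := (sq δ).trans_le (mul_le_mul hy hy hδ (hδ.trans hy))
      _ ≤ _ := Finset.single_le_sum (f := fun y => C.prob k y * C.prob k y)
        (fun y _ => mul_self_nonneg _) (Finset.mem_univ y)
  calc δ ^ 3 = δ * δ ^ 2 := by ring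
    _ ≤ (K.card : ℝ) / 2 ^ n * δ ^ 2 := by gcongr
    _ = ∑ k ∈ K, (1 / 2 ^ n : ℝ) * δ ^ 2 := by
      rw [Finset.sum_const, nsmul_eq_mul]; ring
    _ ≤ ∑ k ∈ K, (1 / 2 ^ n : ℝ) * ∑ y, C.prob k y * C.prob k y :=
      Finset.sum_le_sum fun k hk => by gcongr; exact h2 k hk
    _ ≤ collisionProb C :=
      Finset.sum_le_sum_of_subset_of_nonneg (Finset.subset_univ K) fun k _ _ =>
        mul_nonneg (by positivity) (h1 k)

section Scheme

variable {ℓ : ℕ → ℕ} {G : ∀ n, QCircuit n (ℓ n)}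
  {S : EncScheme (fun n => n * n) ℓ (fun n => n * ℓ n)}

theorem parallelProb_nonneg (n : ℕ) (k : Bits (n * n)) (y : Fin n → Bits (ℓ n)) :
    0 ≤ parallelProb G n k y := Finset.prod_nonneg fun _ _ => QCircuit.prob_nonneg _ _ _

theorem sum_parallelProb (n : ℕ) (k : Bits (n * n)) : ∑ y, parallelProb G n k y = 1 := by
  unfold parallelProb
  rw [← Fintype.prod_sum]
  simp [QCircuit.sum_prob]

/-- Averages over the ciphertext as averages over the runs of the generator. -/
theorem RealizesConstruction.sum_encProb_mul (hS : RealizesConstruction G S) (n : ℕ)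
    (k : Bits (n * n)) (m : Bits (ℓ n)) (f : Bits (n * ℓ n) → ℝ) :
    ∑ c, S.encProb n k m c * f c =
      ∑ y, parallelProb G n k y * f (concat fun i => bxor m (y i)) := by
  simp only [hS.enc, Finset.sum_mul, ite_mul, zero_mul]
  rw [Finset.sum_comm]
  simp

/-- Given the key, the runs in encryption and decryption are independent, so the expected product of
weights factors over the blocks; averaging over the key preserves this because the seeds are
independent too. -/
theorem RealizesConstruction.correctProb_ge (hS : RealizesConstruction G S) (n : ℕ)
    (m : Bits (ℓ n)) : 1 - (8 - 63 / 8 * collisionProb (G n)) ^ n ≤ S.correctProb n m := by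
  have hk : ∀ k : Bits (n * n),
      1 - ∏ i : Fin n, ∑ y, ∑ y', (G n).prob (block k i) y * (G n).prob (block k i) y' *
        pairWeight y y' ≤ ∑ c, S.encProb n k m c * S.decProb n k c m := by
    intro k
    rw [hS.sum_encProb_mul]
    simp only [hS.dec, block_concat]
    have hprod : ∏ i : Fin n, ∑ y, ∑ y', (G n).prob (block k i) y * (G n).prob (block k i) y' *
        pairWeight y y' = ∑ y, ∑ y', parallelProb G n k y * parallelProb G n k y' *
          ∏ i, pairWeight (y i) (y' i) := by
      rw [Fintype.prod_sum]
      refine Finset.sum_congr rfl fun y _ => ?_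
      rw [Fintype.prod_sum]
      refine Finset.sum_congr rfl fun y' _ => ?_
      rw [Finset.prod_mul_distrib, Finset.prod_mul_distrib]
      rfl
    -- Writing 1 as the total mass lets the pointwise bound be compared term by term.
    have hone : (1 : ℝ) = ∑ y, ∑ y', parallelProb G n k y * parallelProb G n k y' := by
      simp only [← Finset.mul_sum, sum_parallelProb, mul_one]
    rw [hprod, hone, ← Finset.sum_sub_distrib]
    refine Finset.sum_le_sum fun y _ => ?_
    rw [← Finset.sum_sub_distrib, Finset.mul_sum]
    refine Finset.sum_le_sum fun y' _ => ?_
    have := mul_le_mul_of_nonneg_left (indicator_maj_ge m y y')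
      (mul_nonneg (parallelProb_nonneg (G := G) n k y) (parallelProb_nonneg (G := G) n k y'))
    calc _ = parallelProb G n k y * parallelProb G n k y' *
          (1 - ∏ i, pairWeight (y i) (y' i)) := by ring
      _ ≤ _ := this
      _ = _ := by split_ifs <;> ring
  have hsum : ∑ k : Bits (n * n), (1 / 2 ^ (n * n) : ℝ) = 1 := by simp
  calc 1 - (8 - 63 / 8 * collisionProb (G n)) ^ n =
        ∑ k : Bits (n * n), (1 / 2 ^ (n * n) : ℝ) *
          (1 - ∏ i : Fin n, ∑ y, ∑ y', (G n).prob (block k i) y * (G n).prob (block k i) y' *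
            pairWeight y y') := by
        simp only [mul_sub, mul_one, Finset.sum_sub_distrib]
        rw [average_prod_block fun _ κ => ∑ y, ∑ y', (G n).prob κ y * (G n).prob κ y' *
          pairWeight y y', hsum]
        rw [average_pairWeight, Finset.prod_const, Finset.card_univ, Fintype.card_fin]
    _ ≤ _ := by
        unfold EncScheme.correctProb
        refine Finset.sum_le_sum fun k _ => ?_
        rw [hS.gen]
        gcongr
        exact hk k

theorem correctProb_nonneg (n : ℕ) (m : Bits (ℓ n)) : 0 ≤ S.correctProb n m :=
  Finset.sum_nonneg fun _ _ => mul_nonneg (QCircuit.prob_nonneg _ _ _) <|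
    Finset.sum_nonneg fun _ _ => mul_nonneg (QCircuit.prob_nonneg _ _ _) (QCircuit.prob_nonneg _ _ _)

theorem negligible_half_pow : Negligible fun n => (1 / 2 : ℝ) ^ n := by
  intro k
  exact tendsto_pow_const_mul_const_pow_of_abs_lt_one k (by norm_num [abs_lt])

theorem RealizesConstruction.correctness (hS : RealizesConstruction G S) (hG : IsStrongQPRG G) :
    ∃ ε : ℕ → ℝ, Negligible ε ∧ ∀ (n : ℕ) (m : Bits (ℓ n)), 1 - ε n ≤ S.correctProb n m := by
  obtain ⟨c, hc, μ, hμ, hK⟩ := hG.pseudodeterminism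
  have hlim : Filter.Tendsto μ Filter.atTop (nhds 0) :=
    hμ.trans_tendsto ((tendsto_rpow_neg_atTop hc).comp tendsto_natCast_atTop_atTop)
  have hev : ∀ᶠ n in Filter.atTop, μ n ≤ 1 / 64 :=
    hlim.eventually (Iic_mem_nhds (by norm_num))
  -- Only convergence of `μ` to 0 matters. The trivial error 1 is used at finitely many `n`.
  refine ⟨fun n => if μ n ≤ 1 / 64 then (1 / 2 : ℝ) ^ n else 1, ?_, fun n m => ?_⟩
  · refine Asymptotics.SuperpolynomialDecay.congr' negligible_half_pow ?_
    filter_upwards [hev] with n hn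
    rw [if_pos hn]
  · simp only
    split_ifs with hn
    · refine le_trans ?_ (hS.correctProb_ge n m)
      obtain ⟨K, hK1, hK2⟩ := hK n
      have hcoll := collisionProb_ge (G n) K (63 / 64) (by norm_num) (by linarith)
        fun k hk => (hK2 k hk).imp fun y hy => by linarith
      -- Numerically, `8 - (63/8)(63/64)^3` is about 0.488.
      have hle : 8 - 63 / 8 * collisionProb (G n) ≤ 1 / 2 := by
        norm_num at hcoll ⊢
        linarith
      have hnn : 0 ≤ 8 - 63 / 8 * collisionProb (G n) := by
        rw [← average_pairWeight]
        refine Finset.sum_nonneg fun k _ => mul_nonneg (by positivity) <|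
          Finset.sum_nonneg fun y _ => Finset.sum_nonneg fun y' _ => mul_nonneg (mul_nonneg
            (QCircuit.prob_nonneg _ _ _) (QCircuit.prob_nonneg _ _ _)) (pairWeight_nonneg _ _)
      have := pow_le_pow_left₀ hnn hle n
      linarith
    · simpa using correctProb_nonneg n m

end Scheme

/-! ### The scheme -/

theorem exists_scheme {ℓ : ℕ → ℕ} (G : ∀ n, QCircuit n (ℓ n)) (hG : IsQPT G) :
    ∃ S : EncScheme (fun n => n * n) ℓ (fun n => n * ℓ n),
      RealizesConstruction G S ∧ IsQPT S.Gen ∧ IsQPT S.Enc ∧ IsQPT S.Dec := by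
  obtain ⟨p, hp⟩ := hG
  choose Gen hGen hGen' using fun n : ℕ => exists_uniform_circuit (n * n)
  choose Enc hEnc hEnc' using fun n : ℕ => exists_enc_circuit (r := n) (G n)
  choose Dec hDec hDec' using fun n : ℕ => exists_dec_circuit (r := n) (G n)
  refine ⟨⟨Gen, Enc, Dec⟩, ⟨fun n k => hGen' n _ k, fun n k m c => hEnc' n k m c,
    fun n k c m => hDec' n k c m⟩, ⟨3 * (Polynomial.X * Polynomial.X), fun n => ?_⟩,
    ⟨4 * (Polynomial.X * p) + 2 * p, fun n => ?_⟩,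
    ⟨Polynomial.X * p + Polynomial.X * p + Polynomial.X * ((Polynomial.X + 1) * p * 75) +
      2 * (Polynomial.X * p + (Polynomial.X * p + (Polynomial.X + 1) * ((Polynomial.X + 1) * p))),
      fun n => ?_⟩⟩
  · simpa using hGen n
  · refine (hEnc n).trans ?_
    simp only [Polynomial.eval_add, Polynomial.eval_mul, Polynomial.eval_X, Polynomial.eval_ofNat]
    gcongr <;> exact hp n
  · refine (hDec n).trans ?_
    simp only [Polynomial.eval_add, Polynomial.eval_mul, Polynomial.eval_X, Polynomial.eval_ofNat,
      Polynomial.eval_one]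
    gcongr <;> exact hp n

/-! ### The reduction -/

theorem sum_bits_add {d a : ℕ} {M : Type*} [AddCommMonoid M] (f : Bits (d + a) → M) :
    ∑ s, f s = ∑ x : Bits d, ∑ α : Bits a, f (Fin.append x α) := by
  rw [← Equiv.sum_comp (Fin.appendEquiv d a), Fintype.sum_prod_type]
  rfl

theorem withAdvice_append {d a : ℕ} (x u v : Bits d) (α β : Bits a)
    (ρ : Matrix (Bits a) (Bits a) ℂ) :
    withAdvice x ρ (Fin.append u α) (Fin.append v β) =
      (Matrix.single x x 1 : Matrix (Bits d) (Bits d) ℂ) u v * ρ α β := by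
  simp [withAdvice]

theorem sum_withAdvice_mul {d a : ℕ} (x : Bits d) (ρ : Matrix (Bits a) (Bits a) ℂ)
    (f : Bits (d + a) → Bits (d + a) → ℂ) :
    ∑ s, ∑ t, withAdvice x ρ s t * f s t =
      ∑ α, ∑ β, ρ α β * f (Fin.append x α) (Fin.append x β) := by
  simp only [sum_bits_add]
  rw [← sum_single_mul x fun u v => ∑ α, ∑ β, ρ α β * f (Fin.append u α) (Fin.append v β)]
  refine Finset.sum_congr rfl fun u _ => ?_
  rw [Finset.sum_comm]
  refine Finset.sum_congr rfl fun v _ => ?_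
  simp only [withAdvice_append, Finset.mul_sum, mul_assoc]

theorem act_ket_of_act_eq {W : Type} [Finite W] [DecidableEq W] {L : List (WGate W)}
    {f : (W → Bool) → (W → Bool)} (h : ∀ (ψ : Amp W) (v : W → Bool), act L ψ (f v) = ψ v)
    (u : W → Bool) : act L (ket u) = ket (f u) := by
  have hb := bijective_of_act_eq h
  funext x
  obtain ⟨v, rfl⟩ := hb.2 x
  rw [h]
  by_cases huv : v = u
  · simp [ket, huv]
  · simp [ket, huv, hb.1.ne huv]

/-- Gates that do not touch the wires `U` leave the basis state there unchanged, as a separate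
factor. -/
theorem act_map_inr_ket {U W : Type} [DecidableEq U] [DecidableEq W] [Fintype U]
    (L : List (WGate W))
    (y : U → Bool) (x : W → Bool) (v : U ⊕ W → Bool) :
    act (L.map (WGate.map Function.Embedding.inr)) (ket (Sum.elim y x)) v =
      (if (fun t => v (Sum.inl t)) = y then 1 else 0) * act L (ket x) fun t => v (Sum.inr t) := by
  rw [act_map]
  have h : (fun u => ket (Sum.elim y x) (Function.extend Function.Embedding.inr u v)) = fun u =>
      (if (fun t => v (Sum.inl t)) = y then 1 else 0) * ket x u := by
    funext u
    have h1 : Function.extend (Function.Embedding.inr : W ↪ U ⊕ W) u v =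
        Sum.elim (fun t => v (Sum.inl t)) u := by
      funext w
      rcases w with w | w
      · rw [Function.extend_apply']
        · rfl
        · rintro ⟨a, ha⟩
          exact Sum.inr_ne_inl ha
      · exact Function.Embedding.inr.injective.extend_apply _ _ _
    rw [h1]
    by_cases hy : (fun t => v (Sum.inl t)) = y <;> by_cases hx : u = x <;>
      simp [ket, Sum.elim_eq_iff, hy, hx]
  rw [h, act_const_mul]
  rfl

/-- Adding `y` to the block number `j`. -/
def addToBlock {r l : ℕ} (j : ℕ) (y : Bits l) (z : Fin r → Bits l) : Fin r → Bits l :=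
  fun i => if (i : ℕ) = j then bxor (z i) y else z i

/-- The challenge is added by CNOT to the input wires of `C` that hold block `j`, and then `C` is
run. An arbitrary `σ` is allowed here; the reduction specializes it. -/
theorem exists_addToBlock_circuit {r l a : ℕ} (C : QCircuit (r * l + a) 1) (j : ℕ) :
    ∃ B : QCircuit (l + (r * l + a)) 1, B.size ≤ r * l + 2 * l + C.size ∧
      ∀ (y : Bits l) (σ : Matrix (Bits (r * l + a)) (Bits (r * l + a)) ℂ) (o : Bits 1),
        B.channel (withAdvice y σ) o o =
          ∑ c, ∑ α, ∑ c', ∑ β, σ (Fin.append c α) (Fin.append c' β) *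
            outcomeMatrix C.wgates C.inp C.out o
              (Fin.append (concat (addToBlock j y (block c))) α)
              (Fin.append (concat (addToBlock j y (block c'))) β) := by
  let e : Fin r × Fin l ↪ Fin l ⊕ Fin C.width :=
    finProdFinEquiv.toEmbedding.trans ((Fin.castAddEmb a).trans
      (C.inp.trans Function.Embedding.inr))
  let F : Fin r × Fin l → (Fin l ⊕ Fin C.width → Bool) → Bool :=
    fun p v => if (p.1 : ℕ) = j then v (Sum.inl p.2) else false
  obtain ⟨L, hL, hact⟩ := implementable_xorFamily (B := 1) e F
    (by
      intro p
      by_cases hp : (p.1 : ℕ) = j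
      · have : F p = fun v => v (Sum.inl p.2) := by funext v; simp [F, hp]
        rw [this]
        exact implementable_cnot Sum.inl_ne_inr
      · have : xorOp (e p) (F p) = fun v => v := by funext v; simp [F, hp, xorOp]
        rw [this]
        exact Implementable.id.mono (Nat.zero_le 1))
    (by
      intro p p' v b
      have h : Function.update v (e p') b (Sum.inl p.2) = v (Sum.inl p.2) :=
        Function.update_of_ne Sum.inl_ne_inr _ _
      simp only [F, h])
  let inp : Fin (l + (r * l + a)) ↪ Fin l ⊕ Fin C.width :=
    finSumFinEquiv.symm.toEmbedding.trans
      (Function.Embedding.sumMap (Function.Embedding.refl _) C.inp)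
  have hinp : ∀ (y : Bits l) (s : Bits (r * l + a)),
      initBits inp (Fin.append y s) = Sum.elim y (initBits C.inp s) := by
    intro y s
    symm
    have hl : ∀ t, inp (Fin.castAdd _ t) = Sum.inl t := fun t => by simp [inp]
    have hr : ∀ t, inp (Fin.natAdd _ t) = Sum.inr (C.inp t) := fun t => by simp [inp]
    refine (eq_initBits_iff _ _ _).2 ⟨?_, ?_⟩
    · funext t
      refine Fin.addCases (fun i => ?_) (fun i => ?_) t
      · rw [hl, Fin.append_left, Sum.elim_inl]
      · rw [hr, Fin.append_right, Sum.elim_inr, initBits_apply]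
    · rintro (t | w) h
      · exact absurd (hl t) (h _)
      · exact initBits_of_notMem _ _ _ fun t ht => h (Fin.natAdd _ t) (by rw [hr, ht])
  have hxor : ∀ (y : Bits l) (c : Bits (r * l)) (α : Bits a),
      xorFamily e F (Sum.elim y (initBits C.inp (Fin.append c α))) =
        Sum.elim y (initBits C.inp (Fin.append (concat (addToBlock j y (block c))) α)) := by
    intro y c α
    have hin : ∀ p, e p = Sum.inr (C.inp (Fin.castAdd a (finProdFinEquiv p))) := fun p => rfl
    funext w
    rcases w with t | w
    · rw [xorFamily_of_notMem]
      · rfl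
      · intro p
        exact Sum.inr_ne_inl
    · by_cases hw : ∃ p, e p = Sum.inr w
      · obtain ⟨p, hp⟩ := hw
        rw [← hp, xorFamily_apply, hin, Sum.elim_inr, Sum.elim_inr, initBits_apply,
          initBits_apply, Fin.append_left, Fin.append_left]
        simp only [F, Sum.elim_inl, concat, Equiv.symm_apply_apply, addToBlock]
        split_ifs
        · rfl
        · simp [block]
      · have hw' : ∀ p, e p ≠ Sum.inr w := fun p hp => hw ⟨p, hp⟩
        rw [xorFamily_of_notMem _ _ _ _ hw', Sum.elim_inr, Sum.elim_inr]
        by_cases hi : ∃ t, C.inp t = w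
        · obtain ⟨t, rfl⟩ := hi
          rw [initBits_apply, initBits_apply]
          revert hw'
          refine Fin.addCases (fun i => ?_) (fun i => ?_) t
          · intro hw'
            exact absurd (by rw [hin, Equiv.apply_symm_apply]) (hw' (finProdFinEquiv.symm i))
          · intro _
            rw [Fin.append_right, Fin.append_right]
        · have hi' : ∀ t, C.inp t ≠ w := fun t ht => hi ⟨t, ht⟩
          rw [initBits_of_notMem _ _ _ hi', initBits_of_notMem _ _ _ hi']
  refine ⟨circuitOf (L ++ C.wgates.map (WGate.map Function.Embedding.inr)) inp
    (C.out.trans Function.Embedding.inr), ?_, fun y σ o => ?_⟩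
  · rw [circuitOf_size, List.length_append, List.length_map]
    simp only [Fintype.card_prod, Fintype.card_fin, mul_one, Fintype.card_sum, QCircuit.size,
      QCircuit.wgates, List.length_map] at hL ⊢
    omega
  · rw [circuitOf_channel_diag, sum_withAdvice_mul]
    simp only [sum_bits_add]
    refine Finset.sum_congr rfl fun c _ => Finset.sum_congr rfl fun α _ =>
      Finset.sum_congr rfl fun c' _ => Finset.sum_congr rfl fun β _ => ?_
    congr 1
    simp only [outcomeMatrix, act_append, hinp, act_ket_of_act_eq hact, hxor, act_map_inr_ket]
    -- The challenge wires still carry `y` at the end, so only that value contributes to the trace.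
    rw [← Equiv.sum_comp (Equiv.sumArrowEquivProdArrow (Fin l) (Fin C.width) Bool).symm,
      Fintype.sum_prod_type, Finset.sum_eq_single y]
    · refine Finset.sum_congr rfl fun v _ => ?_
      simp [Equiv.sumArrowEquivProdArrow]
    · intro y' _ hy'
      refine Finset.sum_eq_zero fun v _ => ?_
      simp [Equiv.sumArrowEquivProdArrow, hy']
    · simp

/-- The advice is the classical mixture of the strings `z` with weights `p z`, tensored with `ρ`. No
sampling procedure for `p` is required, because advice states may be arbitrary. -/
theorem exists_reduction {r l a : ℕ} (C : QCircuit (r * l + a) 1)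
    (ρ : Matrix (Bits a) (Bits a) ℂ) (hρ : IsDensity ρ) (j : ℕ) (p : (Fin r → Bits l) → ℝ)
    (hp : ∀ z, 0 ≤ p z) (hp1 : ∑ z, p z = 1) :
    ∃ (B : QCircuit (l + (r * l + a)) 1) (σ : Matrix (Bits (r * l + a)) (Bits (r * l + a)) ℂ),
      B.size ≤ r * l + 2 * l + C.size ∧ IsDensity σ ∧
      ∀ (y : Bits l) (o : Bits 1), (B.channel (withAdvice y σ) o o).re =
        ∑ z, p z * (C.channel (withAdvice (concat (addToBlock j y z)) ρ) o o).re := by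
  obtain ⟨B, hB, hB'⟩ := exists_addToBlock_circuit C j
  let D : Matrix (Bits (r * l)) (Bits (r * l)) ℂ := Matrix.diagonal fun c => (p (block c) : ℂ)
  let σ : Matrix (Bits (r * l + a)) (Bits (r * l + a)) ℂ :=
    (Matrix.kroneckerMap (· * ·) D ρ).submatrix (Fin.appendEquiv (r * l) a).symm
      (Fin.appendEquiv (r * l) a).symm
  have hσ : ∀ c α c' β, σ (Fin.append c α) (Fin.append c' β) = D c c' * ρ α β := by
    intro c α c' β
    have h : ∀ (c : Bits (r * l)) (α : Bits a),
        (Fin.appendEquiv (r * l) a).symm (Fin.append c α) = (c, α) :=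
      fun c α => (Fin.appendEquiv (r * l) a).symm_apply_apply (c, α)
    simp only [σ, Matrix.submatrix_apply, h, Matrix.kroneckerMap_apply]
  refine ⟨B, σ, hB, ⟨?_, ?_⟩, fun y o => ?_⟩
  · refine Matrix.PosSemidef.submatrix (Matrix.PosSemidef.kronecker ?_ hρ.1) _
    exact Matrix.PosSemidef.diagonal fun c => by
      simpa using hp (block c)
  · have h2 : ∑ c : Bits (r * l), (p (block c) : ℂ) = 1 := by
      refine (Equiv.sum_comp (blockEquiv r l) fun z => (p z : ℂ)).trans ?_
      exact_mod_cast hp1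
    have h3 : ∑ α, ρ α α = 1 := hρ.2
    simp only [Matrix.trace, Matrix.diag_apply, sum_bits_add, hσ, D, Matrix.diagonal_apply_eq,
      ← Finset.mul_sum, h3, mul_one, h2]
  · have h : B.channel (withAdvice y σ) o o = ∑ z, (p z : ℂ) *
        C.channel (withAdvice (concat (addToBlock j y z)) ρ) o o := by
      rw [hB', ← Equiv.sum_comp (blockEquiv r l)]
      refine Finset.sum_congr rfl fun c _ => ?_
      rw [C.channel_diag, sum_withAdvice_mul, Finset.mul_sum]
      refine Finset.sum_congr rfl fun α _ => ?_
      rw [Finset.sum_eq_single c]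
      · rw [Finset.mul_sum]
        refine Finset.sum_congr rfl fun β _ => ?_
        rw [hσ, show D c c = (p (block c) : ℂ) from Matrix.diagonal_apply_eq _ _, mul_assoc]
        rfl
      · intro c' _ hc
        refine Finset.sum_eq_zero fun β _ => ?_
        rw [hσ, show D c c' = 0 from Matrix.diagonal_apply_ne _ hc.symm]
        ring
      · simp
    rw [h, Complex.re_sum]
    simp only [Complex.re_ofReal_mul]

/-! ### The hybrid argument -/

/-- The distributions of the blocks in the hybrid number `j`: the blocks before `j` are
distributed as `u`, the later ones as `q`, and the block `j` as `d`. -/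
def hybridDist {r : ℕ} {Y : Type} (q u d : Y → ℝ) (j : ℕ) (i : Fin r) : Y → ℝ :=
  if (i : ℕ) < j then u else if (i : ℕ) = j then d else q

theorem hybridDist_nonneg {r : ℕ} {Y : Type} {q u d : Y → ℝ} (hq : ∀ y, 0 ≤ q y) (hu : ∀ y, 0 ≤ u y)
    (hd : ∀ y, 0 ≤ d y) (j : ℕ) (i : Fin r) (y : Y) : 0 ≤ hybridDist q u d j i y := by
  unfold hybridDist
  split_ifs
  exacts [hu y, hd y, hq y]

theorem sum_hybridDist {r : ℕ} {Y : Type} [Fintype Y] {q u d : Y → ℝ} (hq : ∑ y, q y = 1) (hu : ∑ y, u y = 1)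
    (hd : ∑ y, d y = 1) (j : ℕ) (i : Fin r) : ∑ y, hybridDist q u d j i y = 1 := by
  unfold hybridDist
  split_ifs
  exacts [hu, hd, hq]

section Hybrid

variable {r : ℕ} {Y : Type} [Fintype Y] [DecidableEq Y]

/-- A tuple is the same as its entry at `j` together with the tuple in which that entry is replaced
by the placeholder `y₀`. -/
theorem sum_eq_sum_update (j : Fin r) (y₀ : Y) (g : (Fin r → Y) → ℝ) :
    ∑ y, g y = ∑ z, ∑ y, if y j = y₀ then g (Function.update y j z) else 0 := by
  have h : ∀ (z : Y) (y : Fin r → Y), (if y j = y₀ then g (Function.update y j z) else 0) =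
      ∑ y', if z = y' j ∧ y = Function.update y' j y₀ then g y' else 0 := by
    intro z y
    have hiff : ∀ y', (z = y' j ∧ y = Function.update y' j y₀) ↔
        (y' = Function.update y j z ∧ y j = y₀) := by
      intro y'
      constructor
      · rintro ⟨rfl, rfl⟩; simp
      · rintro ⟨rfl, rfl⟩; simp
    simp only [hiff, ite_and]
    simp
  simp only [h]
  rw [Finset.sum_congr rfl fun z _ => Finset.sum_comm, Finset.sum_comm]
  refine Finset.sum_congr rfl fun y' _ => ?_
  simp [ite_and]

/-- This isolates the sample at position `j`: the remaining factor is a hybrid with a point mass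
there, which depends on neither `d` nor the sample and can therefore be put into the advice. -/
theorem sum_hybridDist_eq (q u d : Y → ℝ) (j : Fin r) (y₀ : Y) (g : (Fin r → Y) → ℝ) :
    ∑ y : Fin r → Y, (∏ i, hybridDist q u d j i (y i)) * g y =
      ∑ z, d z * ∑ y : Fin r → Y,
        (∏ i, hybridDist q u (fun y => if y = y₀ then 1 else 0) j i (y i)) *
          g (Function.update y j z) := by
  rw [sum_eq_sum_update j y₀]
  refine Finset.sum_congr rfl fun z _ => ?_
  rw [Finset.mul_sum]
  refine Finset.sum_congr rfl fun y _ => ?_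
  have h : ∀ (d : Y → ℝ) (y : Fin r → Y), ∏ i, hybridDist q u d j i (y i) =
      d (y j) * ∏ i ∈ Finset.univ.erase j, hybridDist q u (fun _ => 0) j i (y i) := by
    intro d y
    rw [← Finset.mul_prod_erase Finset.univ _ (Finset.mem_univ j)]
    congr 1
    · simp [hybridDist]
    · refine Finset.prod_congr rfl fun i hi => ?_
      have hne : (i : ℕ) ≠ j := fun h => Finset.ne_of_mem_erase hi (Fin.ext h)
      simp [hybridDist, hne]
  rw [h, h, Function.update_self]
  have h' : ∏ i ∈ Finset.univ.erase j, hybridDist q u (fun _ => 0) j i (Function.update y j z i) =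
      ∏ i ∈ Finset.univ.erase j, hybridDist q u (fun _ => 0) j i (y i) :=
    Finset.prod_congr rfl fun i hi => by
      rw [Function.update_of_ne (Finset.ne_of_mem_erase hi)]
  rw [h']
  split_ifs <;> ring

/-- The product of `q` and the product of `u` are close if `q` and `u` cannot be distinguished at
any position. -/
theorem hybrid_bound (q u : Y → ℝ) (y₀ : Y) (g : (Fin r → Y) → ℝ) (ε : ℝ)
    (h : ∀ j : Fin r, |∑ z, q z * (∑ y : Fin r → Y,
        (∏ i, hybridDist q u (fun y => if y = y₀ then 1 else 0) j i (y i)) *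
          g (Function.update y j z)) - ∑ z, u z * (∑ y : Fin r → Y,
        (∏ i, hybridDist q u (fun y => if y = y₀ then 1 else 0) j i (y i)) *
          g (Function.update y j z))| ≤ ε) :
    |∑ y : Fin r → Y, (∏ i, q (y i)) * g y - ∑ y : Fin r → Y, (∏ i, u (y i)) * g y| ≤ r * ε := by
  let hyb : ℕ → ℝ := fun j => ∑ y : Fin r → Y, (∏ i, hybridDist q u q j i (y i)) * g y
  have h0 : hyb 0 = ∑ y : Fin r → Y, (∏ i, q (y i)) * g y := by
    simp [hyb, hybridDist]
  have hr : hyb r = ∑ y : Fin r → Y, (∏ i, u (y i)) * g y := by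
    simp [hyb, hybridDist]
  -- Consecutive hybrids thus differ only in the distribution placed at position `j`.
  have hs : ∀ j, hybridDist (r := r) q u q (j + 1) = hybridDist q u u j := by
    intro j
    funext i
    unfold hybridDist
    by_cases h1 : (i : ℕ) < j
    · rw [if_pos (by omega), if_pos h1]
    · by_cases h2 : (i : ℕ) = j
      · rw [if_pos (by omega), if_neg h1, if_pos h2]
      · rw [if_neg (by omega), if_neg h1, if_neg h2]
        split_ifs <;> rfl
  have hstep : ∀ j ∈ Finset.range r, |hyb j - hyb (j + 1)| ≤ ε := by
    intro j hj
    have hj' := Finset.mem_range.1 hj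
    have := h ⟨j, hj'⟩
    rw [← sum_hybridDist_eq, ← sum_hybridDist_eq] at this
    simpa only [hyb, hs] using this
  rw [← h0, ← hr, ← Finset.sum_range_sub']
  refine (Finset.abs_sum_le_sum_abs _ _).trans ((Finset.sum_le_sum hstep).trans ?_)
  simp

end Hybrid

/-! ### Security -/

/-- The output distribution of `C` on a uniformly random seed. -/
noncomputable def outputDist {n l : ℕ} (C : QCircuit n l) (y : Bits l) : ℝ :=
  ∑ k : Bits n, (1 / 2 ^ n : ℝ) * C.prob k y

theorem outputDist_nonneg {n l : ℕ} (C : QCircuit n l) (y : Bits l) : 0 ≤ outputDist C y :=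
  Finset.sum_nonneg fun _ _ => mul_nonneg (by positivity) (C.prob_nonneg _ _)

theorem sum_outputDist {n l : ℕ} (C : QCircuit n l) : ∑ y, outputDist C y = 1 := by
  unfold outputDist
  rw [Finset.sum_comm]
  simp [← Finset.mul_sum, C.sum_prob]

theorem sum_uniform (l : ℕ) : ∑ _y : Bits l, (1 / 2 ^ l : ℝ) = 1 := by simp

theorem prgReal_eq {ℓ : ℕ → ℕ} (G : ∀ n, QCircuit n (ℓ n)) (A : Adversary ℓ) (n : ℕ) :
    prgReal G A n = ∑ y, outputDist (G n) y * A.accept n y := by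
  simp only [prgReal, outputDist, Finset.sum_mul, Finset.mul_sum]
  rw [Finset.sum_comm]
  simp only [mul_assoc]

section Scheme

variable {ℓ : ℕ → ℕ} {G : ∀ n, QCircuit n (ℓ n)}
  {S : EncScheme (fun n => n * n) ℓ (fun n => n * ℓ n)}

/-- Averaging over the independent seeds turns the runs into independent samples of the output
distribution. -/
theorem RealizesConstruction.acceptProb_eq (hS : RealizesConstruction G S)
    (A : Adversary fun n => n * ℓ n) (n : ℕ) (m : Bits (ℓ n)) :
    S.acceptProb A n m = ∑ y : Fin n → Bits (ℓ n), (∏ i, outputDist (G n) (y i)) *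
      A.accept n (concat fun i => bxor m (y i)) := by
  simp only [EncScheme.acceptProb, hS.gen, hS.sum_encProb_mul, Finset.mul_sum]
  rw [Finset.sum_comm]
  refine Finset.sum_congr rfl fun y _ => ?_
  simp only [← mul_assoc, ← Finset.sum_mul]
  congr 1
  exact average_prod_block fun i κ => (G n).prob κ (y i)

/-- Adding the same string to all blocks. -/
def bxorEquiv (r : ℕ) {l : ℕ} (m : Bits l) : Equiv.Perm (Fin r → Bits l) where
  toFun y i := bxor m (y i)
  invFun y i := bxor m (y i)
  left_inv y := funext fun i => bxor_bxor_self m (y i)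
  right_inv y := funext fun i => bxor_bxor_self m (y i)

/-- The circuit and the advice of the distinguisher for the hybrid number `j`. -/
theorem exists_distinguisher {n l a : ℕ} (Gn : QCircuit n l) (C : QCircuit (n * l + a) 1)
    (ρ : Matrix (Bits a) (Bits a) ℂ) (hρ : IsDensity ρ) (m : Bits l) (j : ℕ) :
    ∃ (B : QCircuit (l + (n * l + a)) 1) (σ : Matrix (Bits (n * l + a)) (Bits (n * l + a)) ℂ),
      B.size ≤ n * l + 2 * l + C.size ∧ IsDensity σ ∧
      ∀ (hj : j < n) (z : Bits l) (o : Bits 1), (B.channel (withAdvice z σ) o o).re =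
        ∑ y : Fin n → Bits l, (∏ i, hybridDist (outputDist Gn) (fun _ => 1 / 2 ^ l)
          (fun y => if y = fun _ => false then 1 else 0) j i (y i)) *
          (C.channel (withAdvice (concat fun i => bxor m (Function.update y ⟨j, hj⟩ z i)) ρ)
            o o).re := by
  let D : Fin n → Bits l → ℝ := hybridDist (outputDist Gn) (fun _ => 1 / 2 ^ l)
    (fun y => if y = fun _ => false then 1 else 0) j
  obtain ⟨B, σ, hB, hσ, h⟩ := exists_reduction C ρ hρ j (fun y => ∏ i, D i (bxorEquiv n m y i))
    (fun y => Finset.prod_nonneg fun i _ => hybridDist_nonneg (outputDist_nonneg Gn)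
      (fun _ => by positivity) (fun _ => by split_ifs <;> norm_num) j i _)
    (by
      rw [Equiv.sum_comp (bxorEquiv n m) fun y => ∏ i, D i (y i), ← Fintype.prod_sum]
      refine Finset.prod_eq_one fun i _ => ?_
      exact sum_hybridDist (sum_outputDist Gn) (sum_uniform l) (by simp) j i)
  refine ⟨B, σ, hB, hσ, fun hj z o => ?_⟩
  rw [h, ← Equiv.sum_comp (bxorEquiv n m)]
  refine Finset.sum_congr rfl fun y _ => ?_
  have hy : bxorEquiv n m (bxorEquiv n m y) = y := (bxorEquiv n m).left_inv y
  rw [hy]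
  by_cases h0 : y ⟨j, hj⟩ = fun _ => false
  · have : addToBlock j z (bxorEquiv n m y) =
        fun i => bxor m (Function.update y ⟨j, hj⟩ z i) := by
      funext i
      unfold addToBlock
      by_cases hi : (i : ℕ) = j
      · have hi' : i = ⟨j, hj⟩ := Fin.ext hi
        subst hi'
        rw [if_pos rfl, Function.update_self]
        change bxor (bxor m (y ⟨j, hj⟩)) z = _
        rw [h0]
        funext t
        simp [bxor]
      · rw [if_neg hi, Function.update_of_ne fun h => hi (congrArg Fin.val h)]
        rfl
    rw [this]
  · have hD : ∏ i, D i (y i) = 0 :=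
      Finset.prod_eq_zero (Finset.mem_univ ⟨j, hj⟩) (by simp [D, hybridDist, h0])
    rw [hD, zero_mul, zero_mul]

theorem RealizesConstruction.security (hS : RealizesConstruction G S) (hG : IsStrongQPRG G)
    (A : Adversary fun n => n * ℓ n) :
    ∃ ε : ℕ → ℝ, Negligible ε ∧ ∀ (n : ℕ) (m₀ m₁ : Bits (ℓ n)),
      |S.acceptProb A n m₀ - S.acceptProb A n m₁| ≤ ε n := by
  -- Positions range over `Fin (n + 1)`, which is nonempty even for `n = 0`, so that a maximum
  -- exists; the hybrid argument uses only those below `n`.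
  choose B σ hB hσ hacc using fun (n : ℕ) (m : Bits (ℓ n)) (j : Fin (n + 1)) =>
    exists_distinguisher (G n) (A.circuit n) (A.advice n) (A.isDensity n) m (j : ℕ)
  let acc : ∀ n, Bits (ℓ n) → Fin (n + 1) → Bits (ℓ n) → ℝ := fun n m j z =>
    ((B n m j).channel (withAdvice z (σ n m j)) (fun _ => true) (fun _ => true)).re
  let adv : ∀ n, Bits (ℓ n) × Fin (n + 1) → ℝ := fun n x =>
    |∑ z, outputDist (G n) z * acc n x.1 x.2 z - ∑ z, (1 / 2 ^ ℓ n : ℝ) * acc n x.1 x.2 z|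
  -- Taking the largest advantage for each `n` makes one adversary dominate all messages and
  -- positions, so that a single `ε` serves for all of them.
  choose best hbest using fun n => Finite.exists_max (adv n)
  obtain ⟨pG, hpG⟩ := hG.isQPT
  obtain ⟨pA, hpA⟩ := A.isQPT
  let A' : Adversary ℓ :=
    { adviceLen := fun n => n * ℓ n + A.adviceLen n
      circuit := fun n => B n (best n).1 (best n).2
      advice := fun n => σ n (best n).1 (best n).2
      isQPT := by
        refine ⟨Polynomial.X * pG + 2 * pG + pA, fun n => (hB n _ _).trans ?_⟩
        have hl : ℓ n ≤ pG.eval n := (G n).outputs_le.trans (hpG n)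
        simp only [Polynomial.eval_add, Polynomial.eval_mul, Polynomial.eval_X,
          Polynomial.eval_ofNat]
        gcongr
        exact hpA n
      isDensity := fun n => hσ n _ _ }
  obtain ⟨ε, hε, hev⟩ := hG.strongSecurity A'
  have hbound : ∀ n, |prgReal G A' n - prgIdeal A' n| ≤ ε n → ∀ m₀ m₁ : Bits (ℓ n),
      |S.acceptProb A n m₀ - S.acceptProb A n m₁| ≤ 2 * (n * ε n) := by
    intro n hn
    rw [prgReal_eq] at hn
    have hideal : ∀ m : Bits (ℓ n), |S.acceptProb A n m -
        ∑ y : Fin n → Bits (ℓ n), (∏ _i : Fin n, (1 / 2 ^ ℓ n : ℝ)) * A.accept n (concat y)| ≤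
          n * ε n := by
      intro m
      -- Uniform blocks are invariant under adding `m`, so the last hybrid is the same for every
      -- message.
      rw [hS.acceptProb_eq, ← Equiv.sum_comp (bxorEquiv n m) fun y =>
        (∏ _i : Fin n, (1 / 2 ^ ℓ n : ℝ)) * A.accept n (concat y)]
      refine hybrid_bound (outputDist (G n)) (fun _ => 1 / 2 ^ ℓ n) (fun _ => false)
        (fun y => A.accept n (concat fun i => bxor m (y i))) (ε n) fun j => ?_
      refine le_trans (le_of_eq ?_) ((hbest n (m, j.castSucc)).trans hn)
      simp only [adv, acc]
      simp only [hacc n m j.castSucc j.isLt]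
      rfl
    intro m₀ m₁
    have h1 := hideal m₁
    rw [abs_sub_comm] at h1
    rw [two_mul]
    exact (abs_sub_le _ _ _).trans (add_le_add (hideal m₀) h1)
  choose worst hworst using fun n => Finite.exists_max fun x : Bits (ℓ n) × Bits (ℓ n) =>
    |S.acceptProb A n x.1 - S.acceptProb A n x.2|
  -- The security bound must hold for every `n`, whereas strong security holds only eventually; at
  -- the exceptional `n` the exact worst-case advantage is used, which does not affect
  -- negligibility.
  refine ⟨fun n => if |prgReal G A' n - prgIdeal A' n| ≤ ε n then 2 * (n * ε n) else
    |S.acceptProb A n (worst n).1 - S.acceptProb A n (worst n).2|, ?_, ?_⟩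
  · refine Asymptotics.SuperpolynomialDecay.congr' (hε.param_mul.const_mul 2) ?_
    filter_upwards [hev] with n hn
    rw [if_pos hn]
    rfl
  · intro n m₀ m₁
    beta_reduce
    by_cases hn : |prgReal G A' n - prgIdeal A' n| ≤ ε n
    · rw [if_pos hn]
      exact hbound n hn m₀ m₁
    · rw [if_neg hn]
      exact hworst n (m₀, m₁)

end Scheme

end QCrypto

theorem mainTheorem6 (ℓ : ℕ → ℕ) (G : ∀ n : ℕ, QCrypto.QCircuit n (ℓ n))
    (hG : QCrypto.IsStrongQPRG G) (hℓ : ∀ n : ℕ, n ^ 2 < ℓ n) :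
    ∃ S : QCrypto.EncScheme (fun n => n * n) ℓ (fun n => n * ℓ n),
      QCrypto.RealizesConstruction G S ∧ S.IsPOTP := by
  obtain ⟨S, hS, hGen, hEnc, hDec⟩ := QCrypto.exists_scheme G hG.isQPT
  exact ⟨S, hS, hGen, hEnc, hDec, hS.correctness hG, fun n => by simpa [sq] using hℓ n,
    hS.security hG⟩
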